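/- **Setting.** For $k\in\mathbb Z$ let $S_k$ be the set of sequences $\{\alpha\}_k=\{\alpha_i\}_{i\le k}$ of non-negative integers that vanish for all sufficiently negative $i$, let $S=\bigcup_k S_k$, and let $B:S\to\{2,3,\dots\}$, written $\{\alpha\}_k\mapsto B_{\{\alpha\}_k}$. Let $\mathbb S_B$ be the set of sequences $\alpha=\{\alpha_i\}_{i\in\mathbb Z}$ of non-negative integers, vanishing for all sufficiently negative $i$, with $\alpha_{k+1}\le B_{\{\alpha\}_k}-1$ for all $k$. Fix $q>1$ and put $\rho(\alpha,\alpha)=0$, $\rho(\alpha,\beta)=q^{-i_0}$ if $i_0$ is the least index with $\alpha_{i_0}\ne\beta_{i_0}$. Identify $\{\alpha\}_k$ with $\{\beta\in\mathbb S_B:\beta_i=\alpha_i\ \forall i\le k\}$, so that $\{\alpha\}_{-(N+1)}$ is the ball $\{\beta:\rho(\alpha,\beta)\le q^N\}$, and write $\{\alpha\}_k\times\{\gamma\}=\{\beta\in\{\alpha\}_k:\beta_{k+1}=\gamma\}$. Let $\mu$ be the Borel measure on $\mathbb S_B$ with $\mu(\{0\}_{-1})=1$ and $\mu(\{\alpha\}_{-(M+1)})=B_{\{\alpha\}_{-(M+1)}}\,\mu(\{\alpha\}_{-M})$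 for all $\alpha\in\mathbb S_B$, $M\in\mathbb Z$; $L^2(\mathbb S_B,\mu)$ is the real $L^2$ space. Let $a:\mathbb Z\to\mathbb R$ satisfy $a(N)\ge a(N+1)$, $\lim_{N\to\infty}a(N)=0$ and $\lim_{N\to-\infty}a(N)=W\in(0,+\infty]$. For $m\ge1$ put $$B(\alpha,m,M)=(B_{\{\alpha\}_{-(M+m+1)}}-1)\,B_{\{\alpha\}_{-(M+m)}}\cdots B_{\{\alpha\}_{-(M+2)}},\qquad u(\alpha,m,M)=\frac{a(M+m-1)-a(M+m)}{B(\alpha,m,M)}.$$ For $t>0$ put $$Q(\alpha,M,t)=\sum_{n=0}^\infty \frac{B_{\{\alpha\}_{-(M+n+2)}}-1}{B_{\{\alpha\}_{-(M+n+2)}}\cdots B_{\{\alpha\}_{-(M+2)}}}\,e^{-(a(M+n)+u(\alpha,1,M+n))t}.$$ For $\alpha\in\mathbb S_B$ and $t>0$ let $P(\alpha,\cdot,t)$ be the Borel measure on $\mathbb S_B$ with $P(\alpha,\{\beta\}_{-(M+1)},t)=Q(\alpha,M,t)$ if $\beta\in\{\alpha\}_{-(M+1)}$, and $$P(\alpha,\{\beta\}_{-(M+1)},t)=\frac{B_{\{\alpha\}_{-(M+k+1)}}-1}{B(\beta,k,M)\,B_{\{\alpha\}_{-(M+k+1)}}}\Big[Q(\alpha,M+k,t)-e^{-(a(M+k-1)+u(\alpha,1,M+k-1))t}\Big]$$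 if $\rho(\alpha,\beta)=q^{M+k}$, $k\ge1$. Let $T_tf(\eta)=\int f(\xi)\,P(\eta,d\xi,t)$ be the semigroup on $L^2(\mathbb S_B,\mu)$ given by this kernel and let $-H$ be its generator: $Hf=\lim_{t\downarrow0}t^{-1}(f-T_tf)$ in $L^2(\mathbb S_B,\mu)$, with domain the set of all $f$ for which the limit exists. **Theorem.** For $M\in\mathbb Z$ and $\alpha\in\mathbb S_B$ put $s=B_{\{\alpha\}_{-(M+2)}}-1$ and let $E_{M,\alpha}$ be the linear span of the vectors $$e_{M,\alpha}=\sum_{\gamma=0}^{s}b_\gamma\,\chi_{\{\alpha\}_{-(M+2)}\times\{\gamma\}},\qquad b_\gamma\in\mathbb R,\quad \sum_{\gamma=0}^{s}b_\gamma=0 .$$ (a) If $a(M)>0$, then for every $\alpha\in\mathbb S_B$ the number $$h_{M,\alpha}=\big(B_{\{\alpha\}_{-(M+2)}}-1\big)^{-1}\big(B_{\{\alpha\}_{-(M+2)}}a(M)-a(M+1)\big)$$ is an eigenvalue of $H$. The space $E_{M,\alpha}$ has dimension $B_{\{\alpha\}_{-(M+2)}}-1$, every $f\in E_{M,\alpha}$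 satisfies $Hf=h_{M,\alpha}f$, and $E_{M,\alpha}$ consists of exactly those linear combinations $f$ of the functions $\chi_{\{\alpha\}_{-(M+2)}\times\{\gamma\}}$, $0\le\gamma\le s$, that satisfy $Hf=h_{M,\alpha}f$. If $a(M)=0$, then for every $\alpha\in\mathbb S_B$ the function $\chi_{\{\alpha\}_{-(M+1)}}$ is an eigenvector of $H$ to the eigenvalue $0$. (b) The linear span of all vectors $e_{M,\alpha}$, $M\in\mathbb Z$, $\alpha\in\mathbb S_B$, is dense in $L^2(\mathbb S_B,\mu)$. -/

import Mathlib

open MeasureTheory Filter Topology Set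
open scoped ENNReal

noncomputable section

namespace TreeLeaves

/-- `S_k`: the sequences `{α_i}_{i ≤ k}` of nonnegative integers that vanish for all `i ≤ N`,
for some `N ≤ k`. -/
structure LeftSeq (k : ℤ) where
  digit : Set.Iic k → ℕ
  eventually_zero : ∃ N : ℤ, N ≤ k ∧ ∀ i : Set.Iic k, (i : ℤ) ≤ N → digit i = 0

/-- A function `B` on `S = ⋃ₖ S_k` with values in the integers `≥ 2`. -/
structure BranchingFunction where
  toFun : ∀ k : ℤ, LeftSeq k → ℕ
  two_le : ∀ (k : ℤ) (x : LeftSeq k), 2 ≤ toFun k x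

/-- The truncation `{α}_k = {α_i}_{i ≤ k}` of a two-sided sequence. -/
def truncate (d : ℤ → ℕ) (hd : ∃ N : ℤ, ∀ i ≤ N, d i = 0) (k : ℤ) : LeftSeq k where
  digit i := d i
  eventually_zero := by
    obtain ⟨N, hN⟩ := hd
    exact ⟨min N k, min_le_right _ _, fun i hi => hN i (hi.trans (min_le_left _ _))⟩

/-- The space `𝕊_B`: two-sided sequences `{α_i}`, vanishing far to the left, with
`0 ≤ α_{k+1} ≤ B_{{α}_k} - 1` for every `k`. -/
structure SB (B : BranchingFunction) where
  digit : ℤ → ℕ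
  eventually_zero : ∃ N : ℤ, ∀ i ≤ N, digit i = 0
  digit_lt : ∀ k : ℤ, digit (k + 1) < B.toFun k (truncate digit eventually_zero k)

variable {B : BranchingFunction}

namespace SB

@[ext] theorem ext' {α β : SB B} (h : ∀ i, α.digit i = β.digit i) : α = β := by
  cases α; cases β
  have h' := funext h
  simp only at h'
  subst h'
  rfl

/-- The zero sequence. -/
def zero (B : BranchingFunction) : SB B where
  digit _ := 0
  eventually_zero := ⟨0, fun _ _ => rfl⟩
  digit_lt k := lt_of_lt_of_le (by norm_num) (B.two_le _ _)

/-- The number `B_{{α}_k}`. -/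
def branch (α : SB B) (k : ℤ) : ℕ := B.toFun k (truncate α.digit α.eventually_zero k)

theorem two_le_branch (α : SB B) (k : ℤ) : 2 ≤ α.branch k := B.two_le _ _

end SB

/-- `{α}_k` as a subset of `𝕊_B`: all `β` with `{β}_k = {α}_k`. -/
def cyl (α : SB B) (k : ℤ) : Set (SB B) := {β | ∀ i ≤ k, β.digit i = α.digit i}

/-- `{α}_k × {γ}` as a subset of `𝕊_B`. -/
def child (α : SB B) (k : ℤ) (γ : ℕ) : Set (SB B) := {β | β ∈ cyl α k ∧ β.digit (k + 1) = γ}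

/-- The ball `K(α, q^N) = {α}_{-(N+1)}`; see `mem_ball_iff_rho_le`. -/
def ball (α : SB B) (N : ℤ) : Set (SB B) := cyl α (-(N + 1))

/-- For `α ≠ β`, the least index `i₀` with `α_{i₀} ≠ β_{i₀}`. -/
def firstDiff (α β : SB B) : ℤ := sInf {i | α.digit i ≠ β.digit i}

open Classical in
/-- The metric `ρ_q`. -/
def rho (q : ℝ) (α β : SB B) : ℝ := if α = β then 0 else q ^ (-(firstDiff α β))

theorem firstDiff_spec {α β : SB B} (h : α ≠ β) :
    α.digit (firstDiff α β) ≠ β.digit (firstDiff α β) ∧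
      ∀ i < firstDiff α β, α.digit i = β.digit i := by
  have hne : {i | α.digit i ≠ β.digit i}.Nonempty := by
    by_contra hc
    apply h
    ext i
    by_contra hi
    exact hc ⟨i, hi⟩
  have hbdd : BddBelow {i | α.digit i ≠ β.digit i} := by
    obtain ⟨N, hN⟩ := α.eventually_zero
    obtain ⟨N', hN'⟩ := β.eventually_zero
    refine ⟨min N N', fun i hi => ?_⟩
    by_contra hlt
    rw [not_le] at hlt
    exact hi ((hN i (hlt.le.trans (min_le_left _ _))).trans
      (hN' i (hlt.le.trans (min_le_right _ _))).symm)
  refine ⟨Int.csInf_mem hne hbdd, fun i hi => ?_⟩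
  by_contra hc
  exact absurd (csInf_le hbdd hc) (not_le.2 hi)

theorem mem_cyl_iff_rho_lt {q : ℝ} (hq : 1 < q) (α β : SB B) (k : ℤ) :
    β ∈ cyl α k ↔ rho q α β < q ^ (-k) := by
  have hq0 : 0 < q := by linarith
  by_cases h : α = β
  · subst h
    simp only [rho, if_true, cyl, mem_ofPred_eq]
    exact ⟨fun _ => zpow_pos hq0 _, fun _ _ _ => trivial⟩
  · obtain ⟨h1, h2⟩ := firstDiff_spec h
    simp only [rho, if_neg h, cyl, mem_ofPred_eq]
    rw [zpow_lt_zpow_iff_right₀ hq]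
    constructor
    · intro hk
      by_contra hc
      exact h1 (hk _ (by omega)).symm
    · intro hk i hi
      exact (h2 i (by omega)).symm

theorem mem_ball_iff_rho_le {q : ℝ} (hq : 1 < q) (α β : SB B) (N : ℤ) :
    β ∈ ball α N ↔ rho q α β ≤ q ^ N := by
  have hq0 : 0 < q := by linarith
  rw [ball, mem_cyl_iff_rho_lt hq]
  by_cases h : α = β
  · simp only [rho, if_pos h]
    exact ⟨fun _ => (zpow_pos hq0 _).le, fun _ => zpow_pos hq0 _⟩
  · simp only [rho, if_neg h]
    rw [zpow_lt_zpow_iff_right₀ hq, zpow_le_zpow_iff_right₀ hq]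
    omega

/-- The topology of the metrics `ρ_q` (they all induce the same one, see `isOpen_iff_rho`). -/
instance : TopologicalSpace (SB B) where
  IsOpen U := ∀ α ∈ U, ∃ k : ℤ, cyl α k ⊆ U
  isOpen_univ := fun _ _ => ⟨0, subset_univ _⟩
  isOpen_inter := by
    rintro U V hU hV α ⟨hαU, hαV⟩
    obtain ⟨k, hk⟩ := hU α hαU
    obtain ⟨l, hl⟩ := hV α hαV
    exact ⟨max k l, fun β hβ => ⟨hk fun i hi => hβ i (hi.trans (le_max_left _ _)),
      hl fun i hi => hβ i (hi.trans (le_max_right _ _))⟩⟩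
  isOpen_sUnion := by
    rintro s hs α ⟨U, hU, hα⟩
    obtain ⟨k, hk⟩ := hs U hU α hα
    exact ⟨k, hk.trans (subset_sUnion_of_mem hU)⟩

theorem isOpen_iff_rho {q : ℝ} (hq : 1 < q) (U : Set (SB B)) :
    IsOpen U ↔ ∀ α ∈ U, ∃ ε > 0, ∀ β, rho q α β < ε → β ∈ U := by
  have hq0 : 0 < q := by linarith
  constructor
  · intro h α hα
    obtain ⟨k, hk⟩ := h α hα
    exact ⟨q ^ (-k), zpow_pos hq0 _, fun β hβ => hk ((mem_cyl_iff_rho_lt hq α β k).2 hβ)⟩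
  · intro h α hα
    obtain ⟨ε, hε, hU⟩ := h α hα
    obtain ⟨n, hn⟩ := exists_pow_lt_of_lt_one hε (inv_lt_one_of_one_lt₀ hq)
    refine ⟨n, fun β hβ => hU β (((mem_cyl_iff_rho_lt hq α β n).1 hβ).trans ?_)⟩
    simpa [zpow_neg] using hn

instance : MeasurableSpace (SB B) := borel (SB B)

instance : BorelSpace (SB B) := ⟨rfl⟩

theorem isOpen_cyl (α : SB B) (k : ℤ) : IsOpen (cyl α k) :=
  fun _ hβ => ⟨k, fun _ hξ i hi => (hξ i hi).trans (hβ i hi)⟩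

theorem isOpen_child (α : SB B) (k : ℤ) (γ : ℕ) : IsOpen (child α k γ) :=
  fun _ hβ => ⟨k + 1, fun _ hξ => ⟨fun i hi => (hξ i (by omega)).trans (hβ.1 i hi),
    (hξ _ le_rfl).trans hβ.2⟩⟩

/-- The two properties that determine the Borel measure `μ`: `μ({0}_{-1}) = 1` and
`μ({α}_{-(M+1)}) = B_{{α}_{-(M+1)}} μ({α}_{-M})`. -/
def IsMu (ν : Measure (SB B)) : Prop :=
  ν (cyl (SB.zero B) (-1)) = 1 ∧
    ∀ (α : SB B) (M : ℤ), ν (cyl α (-(M + 1))) = (α.branch (-(M + 1)) : ℝ≥0∞) * ν (cyl α (-M))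

open Classical in
/-- The Borel measure `μ` on `𝕊_B`: the unique one with the properties `IsMu`. -/
def mu (B : BranchingFunction) : Measure (SB B) :=
  if h : ∃ ν : Measure (SB B), IsMu ν then h.choose else 0

theorem IsMu.cyl_ne_top {ν : Measure (SB B)} (hν : IsMu ν) (α : SB B) (k : ℤ) :
    ν (cyl α k) ≠ ∞ := by
  obtain ⟨h1, h2⟩ := hν
  have step : ∀ (α : SB B) (j : ℤ), ν (cyl α j) ≠ ∞ ↔ ν (cyl α (j + 1)) ≠ ∞ := by
    intro α j
    have h := h2 α (-j - 1)
    have e1 : -(-j - 1 + 1) = j := by ring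
    have e2 : -(-j - 1) = j + 1 := by ring
    rw [e1, e2] at h
    have hb : (α.branch j : ℝ≥0∞) ≠ 0 := by
      have := α.two_le_branch j
      exact_mod_cast (by omega : α.branch j ≠ 0)
    rw [h]
    constructor
    · intro h3 h4
      rw [h4, ENNReal.mul_top hb] at h3
      exact h3 rfl
    · exact fun h3 => ENNReal.mul_ne_top (ENNReal.natCast_ne_top _) h3
  have all : ∀ (α : SB B) (i j : ℤ), ν (cyl α i) ≠ ∞ → ν (cyl α j) ≠ ∞ := by
    intro α i j hi
    rcases le_total i j with hij | hij
    · induction j, hij using Int.leInduction with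
      | base => exact hi
      | succ k _ ih => exact (step α k).1 ih
    · induction j, hij using Int.leInductionDown with
      | base => exact hi
      | pred k _ ih => exact (step α (k - 1)).2 (by simpa using ih)
  obtain ⟨N, hN⟩ := α.eventually_zero
  have hz : ν (cyl (SB.zero B) N) ≠ ∞ := all _ (-1) N (by rw [h1]; exact ENNReal.one_ne_top)
  have he : cyl α N = cyl (SB.zero B) N := by
    ext β
    simp only [cyl, mem_ofPred_eq, SB.zero]
    exact forall₂_congr fun i hi => by rw [hN i hi]
  exact all α N k (he ▸ hz)

theorem mu_cyl_ne_top (α : SB B) (k : ℤ) : mu B (cyl α k) ≠ ∞ := by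
  unfold mu
  split_ifs with h
  · exact h.choose_spec.cyl_ne_top α k
  · simp

theorem mu_child_ne_top (α : SB B) (k : ℤ) (γ : ℕ) : mu B (child α k γ) ≠ ∞ :=
  measure_ne_top_of_subset (fun _ h => h.1) (mu_cyl_ne_top α k)

/-- `U(N) = a(N-1) - a(N)`. -/
def U (a : ℤ → ℝ) (N : ℤ) : ℝ := a (N - 1) - a N

/-- `B(α, m, M) = (B_{{α}_{-(M+m+1)}} - 1) B_{{α}_{-(M+m)}} ⋯ B_{{α}_{-(M+2)}}`. -/
def BB (α : SB B) (m : ℕ) (M : ℤ) : ℝ :=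
  ((α.branch (-(M + m + 1)) : ℝ) - 1) * ∏ i ∈ Finset.Icc 2 m, (α.branch (-(M + i)) : ℝ)

/-- `u(α, m, M) = B(α, m, M)⁻¹ U(M + m)`. -/
def u (a : ℤ → ℝ) (α : SB B) (m : ℕ) (M : ℤ) : ℝ := (BB α m M)⁻¹ * U a (M + m)

/-- The probability to be in the ball `{α}_{-(M+1)}` at time `t`, starting from `α`:
`∑_{n ≥ 0} (B_{{α}_{-(M+n+2)}} ⋯ B_{{α}_{-(M+2)}})⁻¹ (B_{{α}_{-(M+n+2)}} - 1)
  exp(-(a(M+n) + u(α,1,M+n)) t)`. -/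
def stayProb (a : ℤ → ℝ) (α : SB B) (M : ℤ) (t : ℝ) : ℝ :=
  ∑' n : ℕ, (∏ l ∈ Finset.range (n + 1), (α.branch (-(M + l + 2)) : ℝ))⁻¹ *
    ((α.branch (-(M + n + 2)) : ℝ) - 1) * Real.exp (-(a (M + n) + u a α 1 (M + n)) * t)

open Classical in
/-- The transition function `P_{{α}_{-(M+1)} {β}_{-(M+1)}}(t)`. If the two balls differ,
`k ≥ 1` is determined by `ρ(α, β) = q^(M+k)`. -/
def ballProb (a : ℤ → ℝ) (α β : SB B) (M : ℤ) (t : ℝ) : ℝ :=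
  if β ∈ ball α M then stayProb a α M t
  else
    let k : ℕ := (-(firstDiff α β) - M).toNat
    (BB β k M)⁻¹ * (α.branch (-(M + k + 1)) : ℝ)⁻¹ * ((α.branch (-(M + k + 1)) : ℝ) - 1) *
      (stayProb a α (M + k) t - Real.exp (-(a (M + k - 1) + u a α 1 (M + k - 1)) * t))

open Classical in
/-- The transition kernel `P(α, ·, t)`: the unique Borel measure on `𝕊_B` with
`P(α, {β}_{-(N+1)}, t) = P_{{α}_{-(N+1)} {β}_{-(N+1)}}(t)` for every ball. -/
def transition (a : ℤ → ℝ) (t : ℝ) (α : SB B) : Measure (SB B) :=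
  if h : ∃ ν : Measure (SB B), ∀ (β : SB B) (N : ℤ),
    ν (ball β N) = ENNReal.ofReal (ballProb a α β N t) then h.choose else 0

/-- `(p_t f)(η) = ∫ f(ξ) P(η, dξ, t)`. -/
def markovOp (a : ℤ → ℝ) (t : ℝ) (f : SB B → ℝ) (η : SB B) : ℝ := ∫ ξ, f ξ ∂(transition a t η)

/-- The real Hilbert space `L²(𝕊_B, μ)`. -/
abbrev L2 (B : BranchingFunction) : Type := Lp ℝ 2 (mu B)

open Classical in
/-- The semigroup `T_t` induced by `p_t` on `L²(𝕊_B, μ)`. -/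
def T (a : ℤ → ℝ) (t : ℝ) (f : L2 B) : L2 B :=
  if h : MemLp (markovOp a t f) 2 (mu B) then h.toLp _ else 0

/-- `f ∈ D(H)` and `H f = g`, where `-H` is the generator of `T_t`: `t⁻¹ (f - T_t f) → g` in
`L²(𝕊_B, μ)` as `t ↓ 0`. -/
def HasH (a : ℤ → ℝ) (f g : L2 B) : Prop :=
  Tendsto (fun t : ℝ => t⁻¹ • (f - T a t f)) (𝓝[>] 0) (𝓝 g)

/-- `f` is an eigenvector of `H` to the eigenvalue `lam`. -/
def IsEigenvector (a : ℤ → ℝ) (lam : ℝ) (f : L2 B) : Prop := f ≠ 0 ∧ HasH a f (lam • f)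

/-- `ker (H - lam)`. -/
def kerH (B : BranchingFunction) (a : ℤ → ℝ) (lam : ℝ) : Set (L2 B) := {f | HasH a f (lam • f)}

/-- The indicator function of the ball `{α}_{-(N+1)}`. -/
def chiBall (α : SB B) (N : ℤ) : L2 B :=
  indicatorConstLp 2 (isOpen_cyl α (-(N + 1))).measurableSet (mu_cyl_ne_top α _) 1

/-- The indicator function of `{α}_{-(M+2)} × {γ}`. -/
def chiChild (M : ℤ) (α : SB B) (γ : ℕ) : L2 B :=
  indicatorConstLp 2 (isOpen_child α (-(M + 2)) γ).measurableSet (mu_child_ne_top α _ γ) 1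

/-- `h_{M,α} = (B - 1)⁻¹ (B a(M) - a(M+1))` with `B = B_{{α}_{-(M+2)}}`. -/
def hEig (a : ℤ → ℝ) (M : ℤ) (α : SB B) : ℝ :=
  ((α.branch (-(M + 2)) : ℝ) - 1)⁻¹ * ((α.branch (-(M + 2)) : ℝ) * a M - a (M + 1))

/-- The vectors `e_{M,α} = ∑_{γ=0}^{s} b_γ χ_{{α}_{-(M+2)} × {γ}}` with `s = B_{{α}_{-(M+2)}} - 1`
and `∑ b_γ = 0`. -/
def eVectors (M : ℤ) (α : SB B) : Set (L2 B) :=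
  {f | ∃ b : Fin (α.branch (-(M + 2))) → ℝ, ∑ γ, b γ = 0 ∧ f = ∑ γ, b γ • chiChild M α γ}

end TreeLeaves

end

open TreeLeaves

/-!
# Spectral decomposition of the hierarchical process on `𝕊_B`

Every consistent system of weights on the cylinders is the restriction of a Borel measure
(`IsConsistent.exists_measure`): the outer measure generated by the weights gives each cylinder its
weight, because a countable cover by cylinders of too small a total weight would leave, by König's
lemma, an uncovered point. This yields `μ` (`isMu_mu`), with mass `cylMass`, and the kernels
`P(η, ·, t)` (`transition_ball`). For the kernels one needs nonnegativity of the prescribed values: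
`stayProb a α M t` is an average of the numbers `exp (-h_{M+n,α} t)`, the exponents have mean `a M`
(`hasSum_weights_mul_hEig`), so Jensen's inequality bounds it below by `exp (-a M t)`, which is at
least `exp (-h_{M-1,α} t)`.

Off the point `η` the measure `P(η, ·, t)` is a multiple of `μ` on each ball, so it charges a
`μ`-null set only through a possible atom at `η` (`transition_null`). Hence `T_t` can be computed on
any representative, and on indicators of balls it is given by the transition probabilities. On the
children of `{α}_{-(M+2)}` these are `exp (-h_{M,α} t)` times the identity, plus a term that does
not depend on the child (`exists_ballProb_childBall_eq`). Such a term cancels in a combination with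
coefficient sum `0`, whence `T_t e = exp (-h_{M,α} t) e` for all `e` in `E_{M,α}`.

If a combination of the indicators of the children with nonzero coefficient sum were an
eigenfunction to `h_{M,α}`, then so would be the indicator of the parent ball. Testing this on
spheres around the ball forces `h_{N,α} ≤ a (N + 1)` for all `N > M`; since also
`a (N + 1) ≤ a N ≤ h_{N,α}`, the sequence `a` is constant from `M + 1` on, so it vanishes there.
Then the indicator is an eigenfunction to `0`, whereas `h_{M,α} ≥ a M > 0` (`not_hasH_chiBall`).

For the density, a function orthogonal to all `e_{M,α}` has the same mean over a ball and over its
parent. By Cauchy–Schwarz the means tend to `0` as the balls grow, so all of them vanish, and so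
does the function (`inner_chiBall_eq_zero`, `eq_zero_of_inner_chiBall_eq_zero`).
-/

noncomputable section

namespace TreeLeaves

variable {B : BranchingFunction}

/-! ### Cylinders of the tree -/

theorem truncate_congr {d d' : ℤ → ℕ} (hd : ∃ N : ℤ, ∀ i ≤ N, d i = 0)
    (hd' : ∃ N : ℤ, ∀ i ≤ N, d' i = 0) {k : ℤ} (h : ∀ i ≤ k, d i = d' i) :
    truncate d hd k = truncate d' hd' k := by
  unfold truncate
  congr 1
  funext i
  exact h i i.2

theorem mem_cyl_self (α : SB B) (k : ℤ) : α ∈ cyl α k := fun _ _ => rfl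

theorem mem_cyl_symm {α β : SB B} {k : ℤ} (h : β ∈ cyl α k) : α ∈ cyl β k :=
  fun i hi => (h i hi).symm

theorem mem_cyl_of_le {α β : SB B} {k l : ℤ} (h : β ∈ cyl α k) (hl : l ≤ k) : β ∈ cyl α l :=
  fun i hi => h i (hi.trans hl)

theorem cyl_eq_of_mem {α β : SB B} {k : ℤ} (h : β ∈ cyl α k) : cyl β k = cyl α k := by
  ext ξ
  exact forall₂_congr fun i hi => by rw [h i hi]

theorem cyl_anti (α : SB B) {k l : ℤ} (h : k ≤ l) : cyl α l ⊆ cyl α k :=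
  fun _ hβ => mem_cyl_of_le hβ h

theorem branch_congr {α β : SB B} {k l : ℤ} (h : β ∈ cyl α k) (hl : l ≤ k) :
    β.branch l = α.branch l := by
  unfold SB.branch
  rw [truncate_congr β.eventually_zero α.eventually_zero fun i hi => h i (hi.trans hl)]

/-- The point of `{α}_k × {γ}` whose digits beyond the index `k + 1` vanish. -/
def graft (α : SB B) (k : ℤ) (γ : Fin (α.branch k)) : SB B where
  digit i := if i ≤ k then α.digit i else if i = k + 1 then γ else 0
  eventually_zero := by
    obtain ⟨N, hN⟩ := α.eventually_zero
    refine ⟨min N k, fun i hi => ?_⟩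
    rw [if_pos (hi.trans (min_le_right _ _))]
    exact hN i (hi.trans (min_le_left _ _))
  digit_lt j := by
    rcases lt_trichotomy j k with h | h | h
    · rw [if_pos (by omega)]
      refine (α.digit_lt j).trans_eq ?_
      congr 1
      exact truncate_congr _ _ fun i hi => (if_pos (by omega)).symm
    · subst h
      rw [if_neg (by omega), if_pos rfl]
      refine γ.2.trans_eq ?_
      unfold SB.branch
      congr 1
      exact truncate_congr _ _ fun i hi => (if_pos hi).symm
    · rw [if_neg (by omega), if_neg (by omega)]
      exact lt_of_lt_of_le (by norm_num) (B.two_le _ _)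

theorem graft_digit_le (α : SB B) (k : ℤ) (γ : Fin (α.branch k)) {i : ℤ} (hi : i ≤ k) :
    (graft α k γ).digit i = α.digit i := if_pos hi

theorem graft_digit_succ (α : SB B) (k : ℤ) (γ : Fin (α.branch k)) :
    (graft α k γ).digit (k + 1) = γ := by
  change (if k + 1 ≤ k then α.digit (k + 1) else if k + 1 = k + 1 then (γ : ℕ) else 0) = γ
  rw [if_neg (by omega), if_pos rfl]

theorem graft_digit_gt (α : SB B) (k : ℤ) (γ : Fin (α.branch k)) {i : ℤ} (hi : k + 1 < i) :
    (graft α k γ).digit i = 0 := by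
  change (if i ≤ k then α.digit i else if i = k + 1 then (γ : ℕ) else 0) = 0
  rw [if_neg (by omega), if_neg (by omega)]

theorem graft_mem (α : SB B) (k : ℤ) (γ : Fin (α.branch k)) : graft α k γ ∈ cyl α k :=
  fun _ hi => graft_digit_le α k γ hi

theorem mem_cyl_graft_iff {α β : SB B} {k : ℤ} {γ : Fin (α.branch k)} :
    β ∈ cyl (graft α k γ) (k + 1) ↔ β ∈ cyl α k ∧ β.digit (k + 1) = γ := by
  constructor
  · intro h
    exact ⟨fun i hi => (h i (by omega)).trans (graft_digit_le α k γ hi),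
      (h _ le_rfl).trans (graft_digit_succ α k γ)⟩
  · rintro ⟨h1, h2⟩ i hi
    rcases hi.lt_or_eq with h | rfl
    · rw [graft_digit_le α k γ (by omega)]
      exact h1 i (by omega)
    · rw [graft_digit_succ, h2]

theorem child_eq_cyl_graft (α : SB B) (k : ℤ) (γ : Fin (α.branch k)) :
    child α k γ = cyl (graft α k γ) (k + 1) :=
  Set.ext fun _ => mem_cyl_graft_iff.symm

/-- The child of `{α}_k` to which a point `β ∈ {α}_k` belongs. -/
def childIndex {α β : SB B} {k : ℤ} (h : β ∈ cyl α k) : Fin (α.branch k) :=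
  ⟨β.digit (k + 1), by rw [← branch_congr h le_rfl]; exact β.digit_lt k⟩

theorem mem_graft_childIndex {α β : SB B} {k : ℤ} (h : β ∈ cyl α k) :
    β ∈ cyl (graft α k (childIndex h)) (k + 1) := mem_cyl_graft_iff.2 ⟨h, rfl⟩

theorem mem_cyl_graft_iff_eq {α β : SB B} {k : ℤ} (h : β ∈ cyl α k) {γ : Fin (α.branch k)} :
    β ∈ cyl (graft α k γ) (k + 1) ↔ γ = childIndex h := by
  rw [mem_cyl_graft_iff, Fin.ext_iff]
  exact ⟨fun h' => h'.2.symm, fun h' => ⟨h, h'.symm⟩⟩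

theorem iUnion_cyl_graft (α : SB B) (k : ℤ) :
    ⋃ γ, cyl (graft α k γ) (k + 1) = cyl α k := by
  ext β
  simp only [mem_iUnion]
  exact ⟨fun ⟨γ, h⟩ => (mem_cyl_graft_iff.1 h).1, fun h => ⟨_, mem_graft_childIndex h⟩⟩

/-- A cylinder determines its level, since every vertex has at least two children. -/
theorem le_of_cyl_subset {α β : SB B} {k l : ℤ} (h : cyl α k ⊆ cyl β l) : l ≤ k := by
  by_contra hlt
  have h2 := α.two_le_branch k
  obtain ⟨γ, hγ⟩ : ∃ γ : Fin (α.branch k), (γ : ℕ) ≠ β.digit (k + 1) := by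
    by_cases h0 : β.digit (k + 1) = 0
    · exact ⟨⟨1, by omega⟩, by simp [h0]⟩
    · exact ⟨⟨0, by omega⟩, fun h' => h0 h'.symm⟩
  have := h (graft_mem α k γ) (k + 1) (by omega)
  rw [graft_digit_succ] at this
  exact hγ this

theorem level_eq_of_cyl_eq {α β : SB B} {k l : ℤ} (h : cyl α k = cyl β l) : k = l :=
  le_antisymm (le_of_cyl_subset h.ge) (le_of_cyl_subset h.le)

/-- Nested cylinders have a common point. -/
theorem exists_mem_of_nested (x : ℕ → SB B) (k : ℤ) (hx : ∀ n : ℕ, x (n + 1) ∈ cyl (x n) (k + n)) :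
    ∃ β : SB B, ∀ n : ℕ, β ∈ cyl (x n) (k + n) := by
  have hmono : ∀ m n : ℕ, m ≤ n → x n ∈ cyl (x m) (k + m) := by
    intro m n hmn
    induction n, hmn using Nat.le_induction with
    | base => exact mem_cyl_self _ _
    | succ n hmn ih => exact fun i hi => (hx n i (by omega)).trans (ih i hi)
  have hd : ∀ (n : ℕ) (i : ℤ), i ≤ k + n → (x (i - k).toNat).digit i = (x n).digit i :=
    fun n i hi => (hmono _ n (by omega) i (by omega)).symm
  refine ⟨⟨fun i => (x (i - k).toNat).digit i, ?_, ?_⟩, fun n i hi => hd n i hi⟩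
  · obtain ⟨N, hN⟩ := (x 0).eventually_zero
    refine ⟨min N k, fun i hi => ?_⟩
    have h1 := min_le_left N k
    have h2 := min_le_right N k
    rw [hd 0 i (by push_cast; omega)]
    exact hN i (by omega)
  · intro j
    have h1 : j + 1 ≤ k + ((j + 1 - k).toNat : ℕ) := by omega
    refine ((x (j + 1 - k).toNat).digit_lt j).trans_eq ?_
    congr 1
    exact truncate_congr _ _ fun i hi => (hd (j + 1 - k).toNat i (by omega)).symm

/-! ### The Borel σ-algebra is generated by the cylinders -/

/-- The collection of all cylinders. -/
def cylinders (B : BranchingFunction) : Set (Set (SB B)) :=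
  range fun p : SB B × ℤ => cyl p.1 p.2

theorem cyl_mem_cylinders (α : SB B) (k : ℤ) : cyl α k ∈ cylinders B := ⟨(α, k), rfl⟩

theorem measurableSet_cyl (α : SB B) (k : ℤ) : MeasurableSet (cyl α k) :=
  (isOpen_cyl α k).measurableSet

theorem countable_cylinders (B : BranchingFunction) : (cylinders B).Countable := by
  -- Every cylinder is `{α}_k` with `α` of finite support.
  let F : Set (SB B) := {α | (Function.support α.digit).Finite}
  have hF : F.Countable := by
    have hinj : Function.Injective
        (fun α : F => Finsupp.ofSupportFinite (α : SB B).digit α.2) := by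
      intro α β h
      refine Subtype.ext (SB.ext' fun i => ?_)
      exact DFunLike.congr_fun h i
    exact (Set.countable_coe_iff (s := F)).1 hinj.countable
  have hC : cylinders B ⊆ (fun p : SB B × ℤ => cyl p.1 p.2) '' (F ×ˢ univ) := by
    rintro _ ⟨⟨α, k⟩, rfl⟩
    have hpos : 0 < α.branch k := lt_of_lt_of_le (by norm_num) (α.two_le_branch k)
    refine ⟨(graft α k ⟨0, hpos⟩, k), ⟨?_, mem_univ _⟩, cyl_eq_of_mem (graft_mem _ _ _)⟩
    obtain ⟨N, hN⟩ := (graft α k ⟨0, hpos⟩).eventually_zero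
    refine (Set.finite_Icc N (k + 1)).subset fun i hi => ?_
    by_contra hni
    rw [mem_Icc, not_and_or, not_le, not_le] at hni
    exact hi (hni.elim (fun h => hN i h.le) fun h => graft_digit_gt _ _ _ h)
  exact ((hF.prod countable_univ).image _).mono hC

theorem measurableSpace_eq_generateFrom_cylinders (B : BranchingFunction) :
    (inferInstance : MeasurableSpace (SB B)) = MeasurableSpace.generateFrom (cylinders B) := by
  refine le_antisymm (MeasurableSpace.generateFrom_le fun U hU => ?_)
    (MeasurableSpace.generateFrom_le ?_)
  · have : U = ⋃₀ {s ∈ cylinders B | s ⊆ U} := by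
      ext α
      refine ⟨fun hα => ?_, fun ⟨s, hs, hα⟩ => hs.2 hα⟩
      obtain ⟨k, hk⟩ := hU α hα
      exact ⟨cyl α k, ⟨cyl_mem_cylinders α k, hk⟩, mem_cyl_self α k⟩
    rw [this]
    exact MeasurableSet.sUnion ((countable_cylinders B).mono fun s hs => hs.1)
      fun s hs => MeasurableSpace.measurableSet_generateFrom hs.1
  · rintro _ ⟨⟨α, k⟩, rfl⟩
    exact measurableSet_cyl α k

theorem cyl_inter_cyl {α β : SB B} {k l : ℤ} (h : k ≤ l) (hne : (cyl α k ∩ cyl β l).Nonempty) :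
    cyl α k ∩ cyl β l = cyl β l := by
  obtain ⟨ξ, h1, h2⟩ := hne
  rw [← cyl_eq_of_mem h1, ← cyl_eq_of_mem h2]
  exact inter_eq_right.2 (cyl_anti ξ h)

theorem isPiSystem_cylinders (B : BranchingFunction) : IsPiSystem (cylinders B) := by
  rintro _ ⟨⟨α, k⟩, rfl⟩ _ ⟨⟨β, l⟩, rfl⟩ hne
  dsimp only at hne ⊢
  rcases le_total k l with h | h
  · rw [cyl_inter_cyl h hne]
    exact cyl_mem_cylinders β l
  · rw [inter_comm] at hne ⊢
    rw [cyl_inter_cyl h hne]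
    exact cyl_mem_cylinders α k

/-! ### Measures with prescribed values on the cylinders -/

/-- A consistent system of weights on the cylinders: `w α k` depends only on `{α}_k`, and the
weight of a cylinder is the sum of the weights of its children. -/
structure IsConsistent (w : SB B → ℤ → ℝ≥0∞) : Prop where
  congr : ∀ {α β : SB B} {k : ℤ}, β ∈ cyl α k → w β k = w α k
  sum : ∀ (α : SB B) (k : ℤ), w α k = ∑ γ : Fin (α.branch k), w (graft α k γ) (k + 1)

open Classical in
/-- The set function that is `w` on cylinders, `0` on `∅` and `∞` elsewhere. -/
def cylWeight (w : SB B → ℤ → ℝ≥0∞) (s : Set (SB B)) : ℝ≥0∞ :=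
  if s = ∅ then 0 else ⨅ (p : SB B × ℤ) (_ : s = cyl p.1 p.2), w p.1 p.2

theorem cylWeight_empty (w : SB B → ℤ → ℝ≥0∞) : cylWeight w ∅ = 0 := if_pos rfl

theorem IsConsistent.cylWeight_cyl {w : SB B → ℤ → ℝ≥0∞} (hw : IsConsistent w) (α : SB B)
    (k : ℤ) : cylWeight w (cyl α k) = w α k := by
  rw [cylWeight, if_neg (Set.Nonempty.ne_empty ⟨α, mem_cyl_self α k⟩)]
  refine le_antisymm (iInf₂_le_of_le (α, k) rfl le_rfl) (le_iInf₂ ?_)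
  rintro ⟨β, l⟩ h
  dsimp only at h ⊢
  obtain rfl := level_eq_of_cyl_eq h
  exact (hw.congr (h ▸ mem_cyl_self β k : β ∈ cyl α k)).ge

theorem exists_cyl_of_cylWeight_ne_top {w : SB B → ℤ → ℝ≥0∞} {s : Set (SB B)}
    (h : cylWeight w s ≠ ∞) : s = ∅ ∨ ∃ α k, s = cyl α k := by
  by_contra hc
  rw [not_or] at hc
  refine h ?_
  rw [cylWeight, if_neg hc.1, iInf₂_eq_top]
  rintro ⟨α, k⟩ hs
  exact absurd ⟨α, k, hs⟩ hc.2

/-- The outer measure generated by a system of weights on the cylinders. -/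
def cylOuter (w : SB B → ℤ → ℝ≥0∞) : OuterMeasure (SB B) :=
  OuterMeasure.ofFunction (cylWeight w) (cylWeight_empty w)

open Classical in
/-- König's lemma step: if the sets `t n` that lie inside `{α}_k` have too small a total weight to
cover `{α}_k`, then the same holds for one of the children of `{α}_k`. -/
theorem IsConsistent.exists_child {w : SB B → ℤ → ℝ≥0∞} (hw : IsConsistent w)
    {t : ℕ → Set (SB B)} (ht : ∀ n, t n = ∅ ∨ ∃ α k, t n = cyl α k) {α : SB B} {k : ℤ}
    (hlt : ∑' n, (if t n ⊆ cyl α k then cylWeight w (t n) else 0) < w α k)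
    (hnot : ∀ n, ¬ cyl α k ⊆ t n) :
    ∃ β ∈ cyl α k, ∑' n, (if t n ⊆ cyl β (k + 1) then cylWeight w (t n) else 0) < w β (k + 1) ∧
      ∀ n, ¬ cyl β (k + 1) ⊆ t n := by
  have hsum : ∑ γ : Fin (α.branch k),
      ∑' n, (if t n ⊆ cyl (graft α k γ) (k + 1) then cylWeight w (t n) else 0) ≤
      ∑' n, (if t n ⊆ cyl α k then cylWeight w (t n) else 0) := by
    rw [← Summable.tsum_finsetSum fun _ _ => ENNReal.summable]
    refine ENNReal.tsum_le_tsum fun n => ?_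
    rcases (t n).eq_empty_or_nonempty with h0 | ⟨ξ, hξ⟩
    · simp [h0, cylWeight_empty]
    by_cases hsub : t n ⊆ cyl α k
    · rw [if_pos hsub]
      have hξα := hsub hξ
      refine (Finset.sum_eq_single (childIndex hξα) ?_ ?_).trans_le ?_
      · intro γ _ hγ
        exact if_neg fun h => hγ ((mem_cyl_graft_iff_eq hξα).1 (h hξ))
      · exact fun h => absurd (Finset.mem_univ _) h
      · split_ifs <;> simp
    · rw [if_neg hsub]
      refine (Finset.sum_eq_zero fun γ _ => if_neg fun h => hsub (h.trans ?_)).le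
      rw [← iUnion_cyl_graft α k]
      exact subset_iUnion (fun γ => cyl (graft α k γ) (k + 1)) γ
  have h2 := hsum.trans_lt hlt
  rw [hw.sum α k] at h2
  obtain ⟨γ, -, hγ⟩ := Finset.exists_lt_of_sum_lt h2
  refine ⟨graft α k γ, graft_mem α k γ, hγ, fun n hn => ?_⟩
  rcases ht n with h0 | ⟨β, l, hβ⟩
  · rw [h0] at hn
    exact hn (mem_cyl_self _ _)
  rw [hβ] at hn
  have hle := le_of_cyl_subset hn
  have hmem : graft α k γ ∈ cyl β l := hn (mem_cyl_self _ _)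
  rcases hle.lt_or_eq with hl | rfl
  · refine hnot n ?_
    rw [hβ, ← cyl_eq_of_mem hmem, ← cyl_eq_of_mem (graft_mem α k γ)]
    exact cyl_anti _ (by omega)
  · -- Here `t n` is the child itself, and its own weight contradicts `hγ`.
    have heq : t n = cyl (graft α k γ) (k + 1) := by rw [hβ, cyl_eq_of_mem hmem]
    refine absurd hγ (not_lt.2 ?_)
    refine le_trans ?_ (ENNReal.le_tsum n)
    rw [if_pos heq.le, heq, hw.cylWeight_cyl]

theorem IsConsistent.le_tsum_of_cover {w : SB B → ℤ → ℝ≥0∞} (hw : IsConsistent w)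
    {t : ℕ → Set (SB B)} {α : SB B} {k : ℤ} (hcov : cyl α k ⊆ ⋃ n, t n) :
    w α k ≤ ∑' n, cylWeight w (t n) := by
  classical
  by_contra! hlt
  have ht : ∀ n, t n = ∅ ∨ ∃ α k, t n = cyl α k := fun n =>
    exists_cyl_of_cylWeight_ne_top ((ENNReal.le_tsum n).trans_lt (hlt.trans_le le_top)).ne
  let bad : SB B → ℤ → Prop := fun β j =>
    ∑' n, (if t n ⊆ cyl β j then cylWeight w (t n) else 0) < w β j ∧ ∀ n, ¬ cyl β j ⊆ t n
  have hbad0 : bad α k := by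
    refine ⟨(ENNReal.tsum_le_tsum fun n => ?_).trans_lt hlt, fun n hn => ?_⟩
    · split_ifs <;> simp
    · rcases ht n with h0 | ⟨β, l, hβ⟩
      · rw [h0] at hn
        exact hn (mem_cyl_self _ _)
      · have hle := le_of_cyl_subset (hβ ▸ hn : cyl α k ⊆ cyl β l)
        have hmem : α ∈ cyl β l := hβ ▸ hn (mem_cyl_self _ _)
        -- A cylinder containing `{α}_k` weighs at least as much as `{α}_k`.
        have hmono : ∀ j, l ≤ j → w α j ≤ w α l := by
          intro j hj
          induction j, hj using Int.leInduction with
          | base => exact le_rfl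
          | succ j _ ih =>
            refine le_trans ?_ ih
            rw [hw.sum α j, ← hw.congr (mem_cyl_symm (mem_graft_childIndex (mem_cyl_self α j)))]
            exact Finset.single_le_sum (f := fun γ => w (graft α j γ) (j + 1))
              (fun _ _ => zero_le) (Finset.mem_univ _)
        refine absurd hlt (not_lt.2 ((hmono k hle).trans ?_))
        refine le_trans ?_ (ENNReal.le_tsum n)
        rw [hβ, ← cyl_eq_of_mem hmem, hw.cylWeight_cyl]
  have hstep : ∀ β j, ∃ ξ, bad β j → ξ ∈ cyl β j ∧ bad ξ (j + 1) := by
    intro β j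
    by_cases h : bad β j
    · obtain ⟨ξ, h1, h2⟩ := hw.exists_child ht h.1 h.2
      exact ⟨ξ, fun _ => ⟨h1, h2⟩⟩
    · exact ⟨β, fun h' => absurd h' h⟩
  choose f hf using hstep
  let x : ℕ → SB B := fun n => Nat.rec α (fun n y => f y (k + n)) n
  have hx : ∀ n : ℕ, bad (x n) (k + n) := by
    intro n
    induction n with
    | zero => simpa [x] using hbad0
    | succ n ih =>
      have := (hf _ _ ih).2
      rw [add_assoc] at this
      exact_mod_cast this
  obtain ⟨β, hβ⟩ := exists_mem_of_nested x k fun n => (hf _ _ (hx n)).1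
  have hβα : β ∈ cyl α k := by simpa [x] using hβ 0
  obtain ⟨n, hn⟩ := mem_iUnion.1 (hcov hβα)
  rcases ht n with h0 | ⟨ξ, l, hξ⟩
  · rw [h0] at hn
    exact hn
  · refine (hx (l - k).toNat).2 n ?_
    rw [hξ] at hn ⊢
    rw [← cyl_eq_of_mem hn, ← cyl_eq_of_mem (hβ (l - k).toNat)]
    exact cyl_anti β (by omega)

theorem IsConsistent.cylOuter_cyl {w : SB B → ℤ → ℝ≥0∞} (hw : IsConsistent w) (α : SB B) (k : ℤ) :
    cylOuter w (cyl α k) = w α k := by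
  refine le_antisymm ((OuterMeasure.ofFunction_le _).trans_eq (hw.cylWeight_cyl α k)) ?_
  rw [cylOuter, OuterMeasure.ofFunction_apply]
  exact le_iInf₂ fun t ht => hw.le_tsum_of_cover ht

theorem IsConsistent.cylOuter_diff_add {w : SB B → ℤ → ℝ≥0∞} (hw : IsConsistent w) (β : SB B)
    (k : ℤ) (n : ℕ) : ∀ α : SB B, β ∈ cyl α k →
      cylOuter w (cyl α k \ cyl β (k + n)) + cylOuter w (cyl β (k + n)) ≤ w α k := by
  induction n generalizing k with
  | zero =>
    intro α hα
    simp only [Nat.cast_zero, add_zero, cyl_eq_of_mem hα, sdiff_self, measure_empty, zero_add]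
    exact (hw.cylOuter_cyl α k).le
  | succ n ih =>
    intro α hα
    have hβ := mem_graft_childIndex hα
    have h1 := ih (k + 1) _ hβ
    have hlev : k + 1 + (n : ℤ) = k + ((n + 1 : ℕ) : ℤ) := by push_cast; ring
    rw [hlev] at h1
    have hsub : cyl α k \ cyl β (k + ((n + 1 : ℕ) : ℤ)) ⊆
        (⋃ γ ∈ Finset.univ.erase (childIndex hα), cyl (graft α k γ) (k + 1)) ∪
          (cyl (graft α k (childIndex hα)) (k + 1) \ cyl β (k + ((n + 1 : ℕ) : ℤ))) := by
      rintro ξ ⟨h2, h3⟩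
      by_cases hc : childIndex h2 = childIndex hα
      · exact Or.inr ⟨hc ▸ mem_graft_childIndex h2, h3⟩
      · refine Or.inl (mem_iUnion₂.2 ⟨childIndex h2, ?_, mem_graft_childIndex h2⟩)
        exact Finset.mem_erase.2 ⟨hc, Finset.mem_univ _⟩
    have h2 := (measure_mono hsub).trans (measure_union_le (μ := cylOuter w) _ _)
    have h3 := measure_biUnion_finset_le (μ := cylOuter w) (Finset.univ.erase (childIndex hα))
      fun γ => cyl (graft α k γ) (k + 1)
    simp only [hw.cylOuter_cyl _ (k + 1)] at h3
    rw [hw.sum α k, ← Finset.sum_erase_add _ _ (Finset.mem_univ (childIndex hα))]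
    calc _ ≤ (_ + _) + _ := by gcongr
      _ = _ + (_ + _) := add_assoc _ _ _
      _ ≤ _ := add_le_add h3 h1

theorem IsConsistent.isCaratheodory_cyl {w : SB B → ℤ → ℝ≥0∞} (hw : IsConsistent w) (β : SB B)
    (l : ℤ) : MeasurableSet[(cylOuter w).caratheodory] (cyl β l) := by
  rw [OuterMeasure.isCaratheodory_iff_le]
  -- `t ↦ μ (t ∩ s) + μ (t \ s)` is an outer measure, so it suffices to bound it on cylinders.
  suffices h : OuterMeasure.restrict (cyl β l) (cylOuter w) +
      OuterMeasure.restrict (cyl β l)ᶜ (cylOuter w) ≤ cylOuter w by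
    intro t
    simpa [sdiff_eq] using h t
  refine OuterMeasure.le_ofFunction.2 fun s => ?_
  by_cases htop : cylWeight w s = ∞
  · simp [htop]
  rcases exists_cyl_of_cylWeight_ne_top htop with rfl | ⟨α, k, rfl⟩
  · simp
  rw [hw.cylWeight_cyl]
  simp only [FunLike.coe_add, Pi.add_apply, OuterMeasure.restrict_apply, ← sdiff_eq]
  rcases (cyl α k ∩ cyl β l).eq_empty_or_nonempty with h0 | hne
  · rw [h0, measure_empty, zero_add, ← hw.cylOuter_cyl α k]
    exact measure_mono sdiff_subset
  rcases le_total l k with hlk | hkl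
  · have : cyl α k ⊆ cyl β l := by
      rw [inter_comm] at hne
      exact inter_eq_right.1 (cyl_inter_cyl hlk hne)
    rw [inter_eq_left.2 this, sdiff_eq_empty.2 this, measure_empty, add_zero, hw.cylOuter_cyl]
  · rw [cyl_inter_cyl hkl hne, add_comm]
    obtain ⟨ξ, h1, h2⟩ := hne
    have := hw.cylOuter_diff_add β k (l - k).toNat α
      (fun i hi => ((h2 i (by omega)).symm.trans (h1 i hi)))
    rwa [show k + ((l - k).toNat : ℤ) = l by omega] at this

/-- Every consistent system of weights on the cylinders comes from a Borel measure. -/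
theorem IsConsistent.exists_measure {w : SB B → ℤ → ℝ≥0∞} (hw : IsConsistent w) :
    ∃ ν : Measure (SB B), ∀ α k, ν (cyl α k) = w α k := by
  have hle : (inferInstance : MeasurableSpace (SB B)) ≤ (cylOuter w).caratheodory := by
    rw [measurableSpace_eq_generateFrom_cylinders B]
    refine MeasurableSpace.generateFrom_le ?_
    rintro _ ⟨⟨α, k⟩, rfl⟩
    exact hw.isCaratheodory_cyl α k
  refine ⟨(cylOuter w).toMeasure hle, fun α k => ?_⟩
  rw [toMeasure_apply _ _ (measurableSet_cyl α k), hw.cylOuter_cyl]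

/-! ### The reference measure -/

/-- The `μ`-mass of `{α}_k`. As a formal product it is `∏_{j < -1} B_{{0}_j} / ∏_{j < k} B_{{α}_j}`,
in which almost all factors cancel. -/
def cylMass (α : SB B) (k : ℤ) : ℝ :=
  ∏ᶠ j : ℤ, (if j < -1 then ((SB.zero B).branch j : ℝ) else 1) /
    (if j < k then (α.branch j : ℝ) else 1)

theorem branch_pos (α : SB B) (k : ℤ) : (0 : ℝ) < α.branch k := by
  have := α.two_le_branch k
  exact_mod_cast (by omega : 0 < α.branch k)

theorem two_le_branch_real (α : SB B) (k : ℤ) : (2 : ℝ) ≤ α.branch k := by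
  exact_mod_cast α.two_le_branch k

theorem cylMass_succ (α : SB B) (k : ℤ) : cylMass α k = α.branch k * cylMass α (k + 1) := by
  have hs : (∏ᶠ j : ℤ, if j = k then (α.branch k : ℝ) else 1) = α.branch k := by
    rw [finprod_eq_single _ k fun j hj => if_neg hj, if_pos rfl]
  obtain ⟨N, hN⟩ := α.eventually_zero
  have hb : ∀ j ≤ N, (SB.zero B).branch j = α.branch j := fun j hj =>
    branch_congr (k := N) (fun i hi => (hN i hi).symm) hj
  unfold cylMass
  conv_rhs => rw [← hs]
  rw [← finprod_mul_distrib]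
  · refine finprod_congr fun j => ?_
    have h1 := branch_pos α j
    rcases lt_trichotomy j k with h | h | h
    · rw [if_neg h.ne, if_pos h, if_pos (by omega : j < k + 1), one_mul]
    · subst h
      rw [if_neg (lt_irrefl j), if_pos rfl, if_pos (by omega : j < j + 1)]
      field_simp
    · rw [if_neg h.ne', if_neg (by omega : ¬ j < k), if_neg (by omega : ¬ j < k + 1), one_mul]
  · exact (Set.finite_singleton k).subset fun j hj => by
      by_contra hjk
      exact hj (if_neg hjk)
  · refine (Set.finite_Icc (min N (min (-1) (k + 1))) (max (-1) (k + 1))).subset fun j hj => ?_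
    by_contra hc
    refine hj ?_
    have h1 := branch_pos α j
    rw [mem_Icc, not_and_or, not_le, not_le, lt_min_iff, lt_min_iff, max_lt_iff] at hc
    rcases hc with ⟨h2, h3, h4⟩ | ⟨h3, h4⟩
    · simp only [if_pos h3, if_pos h4, hb j h2.le]
      exact div_self h1.ne'
    · simp only [if_neg h3.not_gt, if_neg h4.not_gt]
      exact div_self one_ne_zero

theorem cylMass_congr {α β : SB B} {k : ℤ} (h : β ∈ cyl α k) : cylMass β k = cylMass α k := by
  refine finprod_congr fun j => ?_
  by_cases hj : j < k
  · rw [if_pos hj, if_pos hj, branch_congr h hj.le]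
  · rw [if_neg hj, if_neg hj]

theorem cylMass_zero : cylMass (SB.zero B) (-1) = 1 := by
  refine finprod_eq_one_of_forall_eq_one fun j => ?_
  have h1 := branch_pos (SB.zero B) j
  split_ifs
  · exact div_self h1.ne'
  · simp

theorem isConsistent_cylMass :
    IsConsistent fun (α : SB B) k => ENNReal.ofReal (cylMass α k) where
  congr h := by rw [cylMass_congr h]
  sum α k := by
    have : ∀ γ : Fin (α.branch k), cylMass (graft α k γ) (k + 1) = cylMass α (k + 1) := by
      intro γ
      have h1 := cylMass_succ (graft α k γ) k
      rw [cylMass_congr (graft_mem α k γ), branch_congr (graft_mem α k γ) le_rfl,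
        cylMass_succ α k] at h1
      exact (mul_left_cancel₀ (branch_pos α k).ne' h1).symm
    simp only [this, Finset.sum_const, Finset.card_univ, Fintype.card_fin, nsmul_eq_mul]
    rw [cylMass_succ, ENNReal.ofReal_mul (branch_pos α k).le, ENNReal.ofReal_natCast]

theorem isMu_mu (B : BranchingFunction) : IsMu (mu B) := by
  have h : ∃ ν : Measure (SB B), IsMu ν := by
    obtain ⟨ν, hν⟩ := isConsistent_cylMass (B := B).exists_measure
    refine ⟨ν, ?_, fun α M => ?_⟩
    · rw [hν, cylMass_zero, ENNReal.ofReal_one]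
    · have h1 := cylMass_succ α (-(M + 1))
      rw [hν, hν, h1, ENNReal.ofReal_mul (branch_pos _ _).le, ENNReal.ofReal_natCast]
      congr 4
      ring
  rw [mu, dif_pos h]
  exact h.choose_spec

/-- The mass `μ({α}_{-(M+1)})` of a ball. -/
def ballMass (α : SB B) (M : ℤ) : ℝ := (mu B).real (ball α M)

theorem mu_ball_eq (α : SB B) (M : ℤ) : mu B (ball α M) = ENNReal.ofReal (ballMass α M) :=
  (ENNReal.ofReal_toReal (mu_cyl_ne_top _ _)).symm

theorem ballMass_succ (α : SB B) (M : ℤ) :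
    ballMass α (M + 1) = α.branch (-(M + 2)) * ballMass α M := by
  have h := (isMu_mu B).2 α (M + 1)
  rw [show -(M + 1 + 1) = -(M + 2) by ring] at h
  unfold ballMass ball Measure.real
  rw [show -(M + 1 + 1) = -(M + 2) by ring, h, ENNReal.toReal_mul, ENNReal.toReal_natCast]

theorem ball_eq_of_mem {α β : SB B} {M : ℤ} (h : β ∈ ball α M) : ball β M = ball α M :=
  cyl_eq_of_mem h

theorem ballMass_congr {α β : SB B} {M : ℤ} (h : β ∈ ball α M) : ballMass β M = ballMass α M := by
  rw [ballMass, ball_eq_of_mem h, ballMass]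

theorem mem_ball_self (α : SB B) (M : ℤ) : α ∈ ball α M := mem_cyl_self α _

theorem mem_ball_symm {α β : SB B} {M : ℤ} (h : β ∈ ball α M) : α ∈ ball β M := mem_cyl_symm h

theorem mem_ball_of_le {α β : SB B} {M N : ℤ} (h : β ∈ ball α M) (hMN : M ≤ N) : β ∈ ball α N :=
  mem_cyl_of_le h (by omega)

/-- Far up the tree, any two points lie in the same ball. -/
theorem exists_mem_ball (α β : SB B) : ∃ N₀ : ℤ, ∀ N ≥ N₀, β ∈ ball α N := by
  obtain ⟨N, hN⟩ := α.eventually_zero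
  obtain ⟨N', hN'⟩ := β.eventually_zero
  refine ⟨-(min N N'), fun K hK i hi => ?_⟩
  have h1 := min_le_left N N'
  have h2 := min_le_right N N'
  rw [hN i (by omega), hN' i (by omega)]

theorem ballMass_pos (α : SB B) (M : ℤ) : 0 < ballMass α M := by
  have hstep : ∀ (β : SB B) (N : ℤ), 0 < ballMass β N ↔ 0 < ballMass β (N + 1) := fun β N => by
    rw [ballMass_succ, mul_pos_iff_of_pos_left (branch_pos _ _)]
  have hall : ∀ (β : SB B) (i j : ℤ), 0 < ballMass β i → 0 < ballMass β j := by
    intro β i j hi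
    rcases le_total i j with hij | hij
    · induction j, hij using Int.leInduction with
      | base => exact hi
      | succ k _ ih => exact (hstep β k).1 ih
    · induction j, hij using Int.leInductionDown with
      | base => exact hi
      | pred k _ ih => exact (hstep β (k - 1)).2 (by simpa using ih)
  have h0 : 0 < ballMass (SB.zero B) 0 := by
    unfold ballMass ball Measure.real
    rw [show (-(0 + 1) : ℤ) = -1 by norm_num, (isMu_mu B).1]
    norm_num
  obtain ⟨N, hN⟩ := exists_mem_ball (SB.zero B) α
  refine hall α N M ?_
  rw [ballMass_congr (hN N le_rfl)]
  exact hall _ 0 N h0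

theorem two_pow_mul_ballMass_le (α : SB B) (M : ℤ) (n : ℕ) :
    2 ^ n * ballMass α M ≤ ballMass α (M + n) := by
  induction n with
  | zero => simp
  | succ n ih =>
    push_cast
    rw [← add_assoc, ballMass_succ, pow_succ']
    have h1 := two_le_branch_real α (-(M + n + 2))
    have h2 := ballMass_pos α (M + n)
    nlinarith

/-! ### The survival probabilities of balls -/

theorem rate_eq_hEig (a : ℤ → ℝ) (α : SB B) (M : ℤ) : a M + u a α 1 M = hEig a M α := by
  have h1 := two_le_branch_real α (-(M + 2))
  have h2 : (α.branch (-(M + 2)) : ℝ) - 1 ≠ 0 := by linarith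
  unfold u BB U hEig
  simp only [Nat.cast_one, add_sub_cancel_right]
  rw [show M + 1 + 1 = M + 2 by ring, Finset.Icc_eq_empty (by norm_num), Finset.prod_empty, mul_one]
  field_simp
  ring

theorem hEig_eq (a : ℤ → ℝ) (M : ℤ) (α : SB B) :
    hEig a M α = a M + (a M - a (M + 1)) / ((α.branch (-(M + 2)) : ℝ) - 1) := by
  have h1 := two_le_branch_real α (-(M + 2))
  have h2 : (α.branch (-(M + 2)) : ℝ) - 1 ≠ 0 := by linarith
  unfold hEig
  field_simp
  ring

theorem le_hEig {a : ℤ → ℝ} (ha : Antitone a) (M : ℤ) (α : SB B) : a M ≤ hEig a M α := by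
  have h1 := two_le_branch_real α (-(M + 2))
  rw [hEig_eq, le_add_iff_nonneg_right]
  exact div_nonneg (sub_nonneg.2 (ha (by omega))) (by linarith)

theorem nonneg_of_antitone {a : ℤ → ℝ} (ha : Antitone a) (ha_top : Tendsto a atTop (𝓝 0)) (M : ℤ) :
    0 ≤ a M := ha.le_of_tendsto ha_top M

theorem hEig_congr (a : ℤ → ℝ) {α β : SB B} {M : ℤ} (h : β ∈ ball α (M + 1)) :
    hEig a M β = hEig a M α := by
  unfold hEig
  rw [branch_congr h (by omega)]

/-- The fraction `μ({α}_{-(M+1)}) / μ({α}_{-(M+n+1)})` of a ball inside its `n`-th ancestor. -/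
def massRatio (α : SB B) (M : ℤ) (n : ℕ) : ℝ := ballMass α M / ballMass α (M + n)

theorem massRatio_zero (α : SB B) (M : ℤ) : massRatio α M 0 = 1 := by
  have := ballMass_pos α M
  simp [massRatio, this.ne']

theorem massRatio_pos (α : SB B) (M : ℤ) (n : ℕ) : 0 < massRatio α M n :=
  div_pos (ballMass_pos _ _) (ballMass_pos _ _)

theorem massRatio_eq_mul (α : SB B) (M : ℤ) (n : ℕ) :
    massRatio α M n = α.branch (-(M + n + 2)) * massRatio α M (n + 1) := by
  have h1 := ballMass_pos α M
  have h2 := ballMass_pos α (M + n)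
  have h3 := branch_pos α (-(M + n + 2))
  unfold massRatio
  push_cast
  rw [← add_assoc, ballMass_succ]
  field_simp

theorem massRatio_succ' (α : SB B) (M : ℤ) (n : ℕ) :
    massRatio α M (n + 1) = (α.branch (-(M + 2)) : ℝ)⁻¹ * massRatio α (M + 1) n := by
  have h1 := ballMass_pos α M
  have h3 := branch_pos α (-(M + 2))
  unfold massRatio
  push_cast
  rw [ballMass_succ, show M + 1 + (n : ℤ) = M + (n + 1) by ring]
  field_simp

theorem antitone_massRatio (α : SB B) (M : ℤ) : Antitone (massRatio α M) := by
  refine antitone_nat_of_succ_le fun n => ?_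
  rw [massRatio_eq_mul α M n]
  have h1 := massRatio_pos α M (n + 1)
  have h2 := two_le_branch_real α (-(M + n + 2))
  nlinarith

theorem massRatio_le (α : SB B) (M : ℤ) (n : ℕ) : massRatio α M n ≤ (1 / 2) ^ n := by
  have h1 := two_pow_mul_ballMass_le α M n
  have h2 := ballMass_pos α (M + n)
  rw [massRatio, div_le_iff₀ h2, one_div, inv_pow, le_inv_mul_iff₀ (by positivity)]
  exact h1

theorem tendsto_massRatio (α : SB B) (M : ℤ) : Tendsto (massRatio α M) atTop (𝓝 0) :=
  squeeze_zero (fun n => (massRatio_pos α M n).le) (massRatio_le α M)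
    (tendsto_pow_atTop_nhds_zero_of_lt_one (by norm_num) (by norm_num))

theorem prod_branch_eq (α : SB B) (M : ℤ) (n : ℕ) :
    ∏ l ∈ Finset.range n, (α.branch (-(M + l + 2)) : ℝ) = (massRatio α M n)⁻¹ := by
  induction n with
  | zero => simp [massRatio_zero]
  | succ n ih =>
    have h1 := massRatio_pos α M (n + 1)
    have h2 := branch_pos α (-(M + n + 2))
    rw [Finset.prod_range_succ, ih, massRatio_eq_mul α M n]
    field_simp

theorem prod_Icc_branch_eq (α : SB B) (M : ℤ) (n : ℕ) :
    ∏ i ∈ Finset.Icc 2 (n + 1), (α.branch (-(M + i)) : ℝ) = (massRatio α M n)⁻¹ := by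
  induction n with
  | zero => simp [massRatio_zero]
  | succ n ih =>
    have h1 := massRatio_pos α M (n + 1)
    have h2 := branch_pos α (-(M + n + 2))
    rw [Finset.prod_Icc_succ_top (by omega), ih, massRatio_eq_mul α M n]
    push_cast
    rw [show M + ((n : ℤ) + 1 + 1) = M + n + 2 by ring]
    field_simp

theorem hasSum_telescope {g : ℕ → ℝ} (hg : Antitone g) (h0 : Tendsto g atTop (𝓝 0)) :
    HasSum (fun n => g n - g (n + 1)) (g 0) := by
  rw [hasSum_iff_tendsto_nat_of_nonneg fun n => sub_nonneg.2 (hg n.le_succ)]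
  simp only [Finset.sum_range_sub']
  simpa using (tendsto_const_nhds (x := g 0)).sub h0

theorem hasSum_weights (α : SB B) (M : ℤ) :
    HasSum (fun n => massRatio α M n - massRatio α M (n + 1)) 1 := by
  simpa [massRatio_zero] using hasSum_telescope (antitone_massRatio α M) (tendsto_massRatio α M)

theorem weights_nonneg (α : SB B) (M : ℤ) (n : ℕ) :
    0 ≤ massRatio α M n - massRatio α M (n + 1) := sub_nonneg.2 (antitone_massRatio α M n.le_succ)

theorem stayProb_eq_tsum (a : ℤ → ℝ) (α : SB B) (M : ℤ) (t : ℝ) :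
    stayProb a α M t = ∑' n : ℕ, (massRatio α M n - massRatio α M (n + 1)) *
      Real.exp (-(hEig a (M + n) α) * t) := by
  refine tsum_congr fun n => ?_
  rw [prod_branch_eq, rate_eq_hEig, inv_inv, massRatio_eq_mul α M n]
  ring

/-- The mean of the exponents `h_{M+n,α}` under the weights occurring in `stayProb` is `a M`. -/
theorem hasSum_weights_mul_hEig {a : ℤ → ℝ} (ha : Antitone a) (ha_top : Tendsto a atTop (𝓝 0))
    (α : SB B) (M : ℤ) :
    HasSum (fun n : ℕ => (massRatio α M n - massRatio α M (n + 1)) * hEig a (M + n) α) (a M) := by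
  have hanti : Antitone fun n : ℕ => massRatio α M n * a (M + n) := by
    intro m n hmn
    exact mul_le_mul (antitone_massRatio α M hmn) (ha (by omega))
      (nonneg_of_antitone ha ha_top _) (massRatio_pos _ _ _).le
  have hlim : Tendsto (fun n : ℕ => massRatio α M n * a (M + n)) atTop (𝓝 0) := by
    refine squeeze_zero (fun n => mul_nonneg (massRatio_pos _ _ _).le
      (nonneg_of_antitone ha ha_top _)) (fun n => mul_le_mul_of_nonneg_left
      (ha (show M ≤ M + (n : ℤ) by omega)) (massRatio_pos _ _ _).le) ?_
    simpa using (tendsto_massRatio α M).mul_const (a M)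
  have := hasSum_telescope hanti hlim
  simp only [massRatio_zero, Nat.cast_zero, add_zero, one_mul] at this
  refine this.congr_fun ?_
  intro n
  have h1 := two_le_branch_real α (-(M + n + 2))
  have h2 : (α.branch (-(M + n + 2)) : ℝ) - 1 ≠ 0 := by linarith
  rw [massRatio_eq_mul α M n, hEig]
  push_cast
  rw [← add_assoc]
  field_simp

theorem summable_stayProb {a : ℤ → ℝ} (ha : Antitone a) (ha_top : Tendsto a atTop (𝓝 0))
    (α : SB B) (M : ℤ) {t : ℝ} (ht : 0 ≤ t) :
    Summable fun n : ℕ => (massRatio α M n - massRatio α M (n + 1)) *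
      Real.exp (-(hEig a (M + n) α) * t) := by
  refine Summable.of_nonneg_of_le (fun n => mul_nonneg (weights_nonneg α M n)
    (Real.exp_pos _).le) (fun n => ?_) (hasSum_weights α M).summable
  refine mul_le_of_le_one_right (weights_nonneg α M n) (Real.exp_le_one_iff.2 ?_)
  have := (nonneg_of_antitone ha ha_top (M + n)).trans (le_hEig ha (M + n) α)
  nlinarith

theorem stayProb_le_one {a : ℤ → ℝ} (ha : Antitone a) (ha_top : Tendsto a atTop (𝓝 0))
    (α : SB B) (M : ℤ) {t : ℝ} (ht : 0 ≤ t) : stayProb a α M t ≤ 1 := by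
  rw [stayProb_eq_tsum, ← (hasSum_weights α M).tsum_eq]
  refine (summable_stayProb ha ha_top α M ht).tsum_le_tsum (fun n => ?_)
    (hasSum_weights α M).summable
  refine mul_le_of_le_one_right (weights_nonneg α M n) (Real.exp_le_one_iff.2 ?_)
  have := (nonneg_of_antitone ha ha_top (M + n)).trans (le_hEig ha (M + n) α)
  nlinarith

/-- Jensen's inequality for the exponential function. -/
theorem exp_le_stayProb {a : ℤ → ℝ} (ha : Antitone a) (ha_top : Tendsto a atTop (𝓝 0))
    (α : SB B) (M : ℤ) {t : ℝ} (ht : 0 ≤ t) : Real.exp (-(a M) * t) ≤ stayProb a α M t := by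
  have hsum : HasSum (fun n : ℕ => (massRatio α M n - massRatio α M (n + 1)) *
      (Real.exp (-(a M) * t) * (1 - (hEig a (M + n) α - a M) * t))) (Real.exp (-(a M) * t)) := by
    have h1 := ((hasSum_weights α M).mul_left (1 + a M * t)).sub
      ((hasSum_weights_mul_hEig ha ha_top α M).mul_left t)
    have h2 := h1.mul_left (Real.exp (-(a M) * t))
    rw [show Real.exp (-(a M) * t) * ((1 + a M * t) * 1 - t * a M) = Real.exp (-(a M) * t) by
      ring] at h2
    refine h2.congr_fun ?_
    intro n
    ring
  rw [stayProb_eq_tsum, ← hsum.tsum_eq]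
  refine hsum.summable.tsum_le_tsum (fun n => ?_) (summable_stayProb ha ha_top α M ht)
  refine mul_le_mul_of_nonneg_left ?_ (weights_nonneg α M n)
  have h1 := Real.add_one_le_exp (-((hEig a (M + n) α - a M) * t))
  have h2 : Real.exp (-(hEig a (M + n) α) * t) =
      Real.exp (-(a M) * t) * Real.exp (-((hEig a (M + n) α - a M) * t)) := by
    rw [← Real.exp_add]
    ring_nf
  rw [h2]
  exact mul_le_mul_of_nonneg_left (by linarith) (Real.exp_pos _).le

theorem stayProb_eq_add {a : ℤ → ℝ} (ha : Antitone a) (ha_top : Tendsto a atTop (𝓝 0))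
    (α : SB B) (M : ℤ) {t : ℝ} (ht : 0 ≤ t) :
    stayProb a α M t = (1 - (α.branch (-(M + 2)) : ℝ)⁻¹) * Real.exp (-(hEig a M α) * t) +
      (α.branch (-(M + 2)) : ℝ)⁻¹ * stayProb a α (M + 1) t := by
  rw [stayProb_eq_tsum, (summable_stayProb ha ha_top α M ht).tsum_eq_zero_add, stayProb_eq_tsum,
    ← tsum_mul_left]
  congr 1
  · rw [massRatio_zero, massRatio_succ', massRatio_zero]
    simp
  · refine tsum_congr fun n => ?_
    rw [massRatio_succ', massRatio_succ']
    push_cast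
    rw [show M + ((n : ℤ) + 1) = M + 1 + n by ring]
    ring

theorem stayProb_congr (a : ℤ → ℝ) {α β : SB B} {M : ℤ} (h : β ∈ ball α (M + 1)) (t : ℝ) :
    stayProb a β M t = stayProb a α M t := by
  have hb : ∀ n : ℕ, β.branch (-(M + n + 2)) = α.branch (-(M + n + 2)) := fun n =>
    branch_congr h (by omega)
  refine tsum_congr fun n => ?_
  simp only [rate_eq_hEig, hb]
  rw [hEig_congr a (mem_ball_of_le h (by omega : M + 1 ≤ M + n + 1))]

/-! ### The transition probabilities -/

theorem firstDiff_eq {α β : SB B} {N : ℤ} (h : β ∈ ball α N) (h' : β ∉ ball α (N - 1)) :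
    firstDiff α β = -N := by
  have hne : α ≠ β := by
    rintro rfl
    exact h' (mem_ball_self _ _)
  obtain ⟨h1, h2⟩ := firstDiff_spec hne
  have h3 : -N ≤ firstDiff α β := by
    by_contra hc
    exact h1 (h _ (by omega)).symm
  by_contra hc
  exact h' fun i hi => (h2 i (by omega)).symm

theorem exists_sphere {α β : SB B} {M : ℤ} (h : β ∉ ball α M) :
    ∃ N, M < N ∧ β ∈ ball α N ∧ β ∉ ball α (N - 1) := by
  have hne : α ≠ β := by
    rintro rfl
    exact h (mem_ball_self _ _)
  obtain ⟨h1, h2⟩ := firstDiff_spec hne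
  refine ⟨-firstDiff α β, ?_, fun i hi => (h2 i (by omega)).symm, fun hb => ?_⟩
  · by_contra hc
    exact h fun i hi => (h2 i (by omega)).symm
  · exact h1 (hb _ (by omega)).symm

/-- `P(α, K, t) = excess * μ(K) / μ({α}_{-(N+1)})` for balls `K` in the sphere
`{α}_{-(N+1)} \ {α}_{-N}`. -/
def excess (a : ℤ → ℝ) (α : SB B) (N : ℤ) (t : ℝ) : ℝ :=
  stayProb a α N t - Real.exp (-(hEig a (N - 1) α) * t)

theorem exp_sub_exp_le_excess {a : ℤ → ℝ} (ha : Antitone a) (ha_top : Tendsto a atTop (𝓝 0))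
    (α : SB B) (N : ℤ) {t : ℝ} (ht : 0 ≤ t) :
    Real.exp (-(a N) * t) - Real.exp (-(hEig a (N - 1) α) * t) ≤ excess a α N t :=
  sub_le_sub_right (exp_le_stayProb ha ha_top α N ht) _

theorem excess_nonneg {a : ℤ → ℝ} (ha : Antitone a) (ha_top : Tendsto a atTop (𝓝 0))
    (α : SB B) (N : ℤ) {t : ℝ} (ht : 0 ≤ t) : 0 ≤ excess a α N t := by
  refine le_trans ?_ (exp_sub_exp_le_excess ha ha_top α N ht)
  rw [sub_nonneg, Real.exp_le_exp]
  have h1 := le_hEig ha (N - 1) α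
  have h2 := ha (show N - 1 ≤ N by omega)
  nlinarith

theorem excess_le_one {a : ℤ → ℝ} (ha : Antitone a) (ha_top : Tendsto a atTop (𝓝 0))
    (α : SB B) (N : ℤ) {t : ℝ} (ht : 0 ≤ t) : excess a α N t ≤ 1 :=
  (sub_le_self _ (Real.exp_pos _).le).trans (stayProb_le_one ha ha_top α N ht)

theorem excess_congr (a : ℤ → ℝ) {α β : SB B} {N : ℤ} (h : β ∈ ball α N) (t : ℝ) :
    excess a β N t = excess a α N t := by
  unfold excess
  rw [stayProb_congr a (mem_ball_of_le h (by omega)), hEig_congr a (M := N - 1) (by simpa using h)]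

theorem ballProb_of_mem (a : ℤ → ℝ) {α β : SB B} {M : ℤ} (h : β ∈ ball α M) (t : ℝ) :
    ballProb a α β M t = stayProb a α M t := if_pos h

theorem ballProb_of_sphere (a : ℤ → ℝ) {α β : SB B} {M N : ℤ} (hMN : M < N) (h : β ∈ ball α N)
    (h' : β ∉ ball α (N - 1)) (t : ℝ) :
    ballProb a α β M t = ballMass β M / ballMass β N * excess a α N t := by
  obtain ⟨k, rfl⟩ : ∃ k : ℕ, N = M + (k + 1 : ℕ) := ⟨(N - M - 1).toNat, by omega⟩
  have hk : (-(firstDiff α β) - M).toNat = k + 1 := by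
    rw [firstDiff_eq h h']
    omega
  rw [ballProb, if_neg fun hc => h' (mem_ball_of_le hc (by omega))]
  dsimp only
  have hbr : α.branch (-(M + (k + 1 : ℕ) + 1)) = β.branch (-(M + (k + 1 : ℕ) + 1)) :=
    (branch_congr h le_rfl).symm
  have h1 := massRatio_pos β M (k + 1)
  have h2 := two_le_branch_real β (-(M + (k + 1 : ℕ) + 1))
  have h3 := massRatio_eq_mul β M k
  rw [hk, rate_eq_hEig, ← excess, ← massRatio, hbr, BB]
  have hmul : (β.branch (-(M + (k + 1 : ℕ) + 1)) : ℝ) *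
      ∏ i ∈ Finset.Icc 2 (k + 1), (β.branch (-(M + i)) : ℝ) = (massRatio β M (k + 1))⁻¹ := by
    rw [← prod_Icc_branch_eq β M (k + 1), Finset.prod_Icc_succ_top (b := k + 1) (by omega),
      mul_comm, show M + ((k + 1 : ℕ) : ℤ) + 1 = M + ((k + 1 + 1 : ℕ) : ℤ) by push_cast; ring]
  have hprod : (0 : ℝ) < ∏ i ∈ Finset.Icc 2 (k + 1), (β.branch (-(M + i)) : ℝ) :=
    Finset.prod_pos fun i _ => branch_pos β _
  rw [show massRatio β M (k + 1) = (massRatio β M (k + 1))⁻¹⁻¹ by rw [inv_inv], ← hmul]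
  have h4 : (β.branch (-(M + (k + 1 : ℕ) + 1)) : ℝ) - 1 ≠ 0 := by linarith
  have h5 : (β.branch (-(M + (k + 1 : ℕ) + 1)) : ℝ) ≠ 0 := by linarith
  field_simp

theorem ballProb_nonneg {a : ℤ → ℝ} (ha : Antitone a) (ha_top : Tendsto a atTop (𝓝 0))
    (α β : SB B) (M : ℤ) {t : ℝ} (ht : 0 ≤ t) : 0 ≤ ballProb a α β M t := by
  by_cases h : β ∈ ball α M
  · rw [ballProb_of_mem a h]
    exact (Real.exp_pos _).le.trans (exp_le_stayProb ha ha_top α M ht)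
  · obtain ⟨N, h1, h2, h3⟩ := exists_sphere h
    rw [ballProb_of_sphere a h1 h2 h3]
    exact mul_nonneg (div_nonneg (ballMass_pos _ _).le (ballMass_pos _ _).le)
      (excess_nonneg ha ha_top α N ht)

theorem ballProb_congr (a : ℤ → ℝ) {α β ξ : SB B} {M : ℤ} (h : ξ ∈ ball β M) (t : ℝ) :
    ballProb a α ξ M t = ballProb a α β M t := by
  have key : ∀ N, M ≤ N → (ξ ∈ ball α N ↔ β ∈ ball α N) := fun N hN => by
    have h1 := mem_ball_of_le h hN
    constructor
    · exact fun h2 i hi => (h1 i hi).symm.trans (h2 i hi)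
    · exact fun h2 i hi => (h1 i hi).trans (h2 i hi)
  by_cases hM : β ∈ ball α M
  · rw [ballProb_of_mem a hM, ballProb_of_mem a ((key M le_rfl).2 hM)]
  · obtain ⟨N, h1, h2, h3⟩ := exists_sphere hM
    rw [ballProb_of_sphere a h1 h2 h3, ballProb_of_sphere a h1 ((key N h1.le).2 h2)
      (fun hc => h3 ((key (N - 1) (by omega)).1 hc)), ballMass_congr h,
      ballMass_congr (mem_ball_of_le h h1.le)]

/-- A point of `{β}_{-(M+2)} × {γ}`; this child is the ball `ball (childBall β M γ) M`. -/
def childBall (β : SB B) (M : ℤ) (γ : Fin (β.branch (-(M + 2)))) : SB B := graft β (-(M + 2)) γ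

theorem mem_ball_childBall_iff {α β : SB B} {M : ℤ} {γ : Fin (β.branch (-(M + 2)))} :
    α ∈ ball (childBall β M γ) M ↔ α ∈ cyl (graft β (-(M + 2)) γ) (-(M + 2) + 1) := by
  rw [ball, childBall, show -(M + 1) = -(M + 2) + 1 by ring]

theorem child_eq_ball (β : SB B) (M : ℤ) (γ : Fin (β.branch (-(M + 2)))) :
    child β (-(M + 2)) γ = ball (childBall β M γ) M := by
  ext α
  rw [mem_ball_childBall_iff, child_eq_cyl_graft]

theorem childBall_mem (β : SB B) (M : ℤ) (γ : Fin (β.branch (-(M + 2)))) :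
    childBall β M γ ∈ ball β (M + 1) := by
  rw [ball, show -(M + 1 + 1) = -(M + 2) by ring]
  exact graft_mem _ _ _

theorem exists_childBall {α β : SB B} {M : ℤ} (h : α ∈ ball β (M + 1)) :
    ∃ γ₀, ∀ γ, α ∈ ball (childBall β M γ) M ↔ γ = γ₀ := by
  rw [ball, show -(M + 1 + 1) = -(M + 2) by ring] at h
  refine ⟨childIndex h, fun γ => ?_⟩
  rw [mem_ball_childBall_iff, mem_cyl_graft_iff_eq h]

theorem not_mem_childBall {α β : SB B} {M : ℤ} (h : α ∉ ball β (M + 1))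
    (γ : Fin (β.branch (-(M + 2)))) : α ∉ ball (childBall β M γ) M := fun hc =>
  h (ball_eq_of_mem (childBall_mem β M γ) ▸ mem_ball_of_le hc (by omega))

theorem ballMass_childBall (β : SB B) (M : ℤ) (γ : Fin (β.branch (-(M + 2)))) :
    ballMass (childBall β M γ) M = (β.branch (-(M + 2)) : ℝ)⁻¹ * ballMass β (M + 1) := by
  have h1 := ballMass_succ (childBall β M γ) M
  have h2 := branch_pos β (-(M + 2))
  rw [ballMass_congr (childBall_mem β M γ), branch_congr (childBall_mem β M γ) (by omega)] at h1
  rw [h1]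
  field_simp

/-- The transition probability from a point into the children of `{β}_{-(M+2)}`, if the point lies
in this ball but not in the child. -/
theorem ballProb_sibling (a : ℤ → ℝ) {α β : SB B} {M : ℤ} (h : α ∈ ball β (M + 1))
    {γ : Fin (β.branch (-(M + 2)))} (hγ : α ∉ ball (childBall β M γ) M) (t : ℝ) :
    ballProb a α (childBall β M γ) M t =
      (β.branch (-(M + 2)) : ℝ)⁻¹ * excess a β (M + 1) t := by
  have h1 := childBall_mem β M γ
  have h2 : childBall β M γ ∈ ball α (M + 1) := by rwa [ball_eq_of_mem h]
  have h3 := ballMass_pos β (M + 1)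
  rw [ballProb_of_sphere a (by omega) h2 (fun hc => hγ (mem_ball_symm (by simpa using hc))),
    ballMass_congr h1, ballMass_childBall, excess_congr a h]
  field_simp

/-- The transition probabilities from a point outside `{β}_{-(M+2)}` into the children of this
ball all agree. -/
theorem ballProb_outside (a : ℤ → ℝ) {α β : SB B} {M : ℤ} (h : α ∉ ball β (M + 1))
    (γ : Fin (β.branch (-(M + 2)))) (t : ℝ) :
    ballProb a α (childBall β M γ) M t =
      (β.branch (-(M + 2)) : ℝ)⁻¹ * ballProb a α β (M + 1) t := by
  have h1 := childBall_mem β M γ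
  have h4 : childBall β M γ ∉ ball α (M + 1) := fun hc =>
    h (by rw [← ball_eq_of_mem h1]; exact mem_ball_symm hc)
  obtain ⟨N, h5, h6, h7⟩ := exists_sphere h4
  rw [ballProb_of_sphere a (by omega) h6 h7, ← ballProb_congr a h1,
    ballProb_of_sphere a h5 h6 h7, ballMass_childBall, ballMass_congr h1]
  ring

theorem ballProb_sum {a : ℤ → ℝ} (ha : Antitone a) (ha_top : Tendsto a atTop (𝓝 0))
    (α β : SB B) (M : ℤ) {t : ℝ} (ht : 0 ≤ t) :
    ballProb a α β (M + 1) t = ∑ γ, ballProb a α (childBall β M γ) M t := by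
  have hb := branch_pos β (-(M + 2))
  by_cases h : α ∈ ball β (M + 1)
  · obtain ⟨γ₀, hγ₀⟩ := exists_childBall h
    rw [← Finset.add_sum_erase _ _ (Finset.mem_univ γ₀), Finset.sum_congr rfl fun γ hγ =>
      ballProb_sibling a h (fun hc => (Finset.mem_erase.1 hγ).1 ((hγ₀ γ).1 hc)) t,
      ballProb_of_mem a (mem_ball_symm h), ballProb_of_mem a (mem_ball_symm ((hγ₀ γ₀).2 rfl)),
      stayProb_eq_add ha ha_top α M ht, Finset.sum_const, Finset.card_erase_of_mem
      (Finset.mem_univ _), Finset.card_univ, Fintype.card_fin, nsmul_eq_mul,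
      Nat.cast_sub (by have := β.two_le_branch (-(M + 2)); omega), branch_congr h (by omega),
      excess, hEig_congr a h, stayProb_congr a (mem_ball_of_le h (by omega : M + 1 ≤ M + 1 + 1)),
      add_sub_cancel_right]
    field_simp
    push_cast
    ring
  · rw [Finset.sum_congr rfl fun γ _ => ballProb_outside a h γ t, Finset.sum_const,
      Finset.card_univ, Fintype.card_fin, nsmul_eq_mul]
    field_simp

theorem transition_ball {a : ℤ → ℝ} (ha : Antitone a) (ha_top : Tendsto a atTop (𝓝 0))
    (α β : SB B) (M : ℤ) {t : ℝ} (ht : 0 ≤ t) :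
    transition a t α (ball β M) = ENNReal.ofReal (ballProb a α β M t) := by
  have hw : IsConsistent fun (β : SB B) k =>
      ENNReal.ofReal (ballProb a α β (-(k + 1)) t) := by
    constructor
    · intro β ξ k h
      rw [ballProb_congr a (by rwa [ball, neg_add, neg_neg, add_neg_cancel_right])]
    · intro β k
      obtain ⟨M, rfl⟩ : ∃ M : ℤ, k = -(M + 2) := ⟨-k - 2, by ring⟩
      rw [show -(-(M + 2) + 1) = M + 1 by ring, ballProb_sum ha ha_top α β M ht,
        ENNReal.ofReal_sum_of_nonneg fun γ _ => ballProb_nonneg ha ha_top _ _ _ ht]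
      refine Finset.sum_congr rfl fun γ _ => ?_
      rw [show -(-(M + 2) + 1 + 1) = M by ring, childBall]
  have hex : ∃ ν : Measure (SB B), ∀ (β : SB B) (N : ℤ),
      ν (ball β N) = ENNReal.ofReal (ballProb a α β N t) := by
    obtain ⟨ν, hν⟩ := hw.exists_measure
    refine ⟨ν, fun β N => ?_⟩
    rw [ball, hν]
    congr 2
    ring
  rw [transition, dif_pos hex]
  exact hex.choose_spec β M

/-! ### The kernel and null sets -/

theorem ball_inter_ball (α : SB B) (M N : ℤ) : ball α M ∩ ball α N = ball α (min M N) := by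
  rcases le_total M N with h | h
  · rw [min_eq_left h]
    exact inter_eq_left.2 fun β hβ => mem_ball_of_le hβ h
  · rw [min_eq_right h]
    exact inter_eq_right.2 fun β hβ => mem_ball_of_le hβ h

theorem measurableSet_ball (α : SB B) (M : ℤ) : MeasurableSet (ball α M) := measurableSet_cyl α _

theorem cyl_eq_ball (α : SB B) (k : ℤ) : cyl α k = ball α (-(k + 1)) := by
  rw [ball]
  congr 1
  ring

variable {a : ℤ → ℝ}

/-- On a ball that does not contain `η`, the measure `P(η, ·, t)` is a multiple of `μ`. -/
theorem transition_restrict_ball (ha : Antitone a) (ha_top : Tendsto a atTop (𝓝 0)) {t : ℝ}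
    (ht : 0 ≤ t) {η ξ : SB B} {M : ℤ} (h : η ∉ ball ξ M) :
    ∃ c : ℝ≥0∞, (transition a t η).restrict (ball ξ M) = c • (mu B).restrict (ball ξ M) := by
  obtain ⟨N, h1, h2, h3⟩ := exists_sphere fun hc => h (mem_ball_symm hc)
  have hval : ∀ ζ ∈ ball ξ M, ∀ K ≤ M, transition a t η (ball ζ K) =
      ENNReal.ofReal (excess a η N t / ballMass ξ N) * mu B (ball ζ K) := by
    intro ζ hζ K hK
    have hN := mem_ball_of_le hζ h1.le
    have h4 : ζ ∈ ball η N := ball_eq_of_mem h2 ▸ hN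
    have h5 : ζ ∉ ball η (N - 1) := fun hc => h3 <| by
      rw [← ball_eq_of_mem hc]
      exact mem_ball_symm (mem_ball_of_le hζ (by omega))
    rw [transition_ball ha ha_top η ζ K ht, ballProb_of_sphere a (by omega) h4 h5, mu_ball_eq,
      ← ENNReal.ofReal_mul (div_nonneg (excess_nonneg ha ha_top η N ht) (ballMass_pos _ _).le),
      ballMass_congr hN]
    congr 1
    ring
  refine ⟨ENNReal.ofReal (excess a η N t / ballMass ξ N), ?_⟩
  have hfin : IsFiniteMeasure ((transition a t η).restrict (ball ξ M)) := ⟨by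
    rw [Measure.restrict_apply_univ, transition_ball ha ha_top η ξ M ht]
    exact ENNReal.ofReal_lt_top⟩
  refine ext_of_generate_finite (cylinders B) (measurableSpace_eq_generateFrom_cylinders B)
    (isPiSystem_cylinders B) ?_ ?_
  · rintro _ ⟨⟨β, k⟩, rfl⟩
    dsimp only
    rw [Measure.smul_apply, smul_eq_mul, Measure.restrict_apply (measurableSet_cyl β k),
      Measure.restrict_apply (measurableSet_cyl β k), cyl_eq_ball]
    rcases (ball β (-(k + 1)) ∩ ball ξ M).eq_empty_or_nonempty with h0 | ⟨ζ, hζ1, hζ2⟩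
    · rw [h0, measure_empty, measure_empty, mul_zero]
    · rw [← ball_eq_of_mem hζ1, ← ball_eq_of_mem hζ2, ball_inter_ball]
      exact hval ζ hζ2 _ (min_le_right _ _)
  · rw [Measure.smul_apply, smul_eq_mul, Measure.restrict_apply_univ, Measure.restrict_apply_univ]
    exact hval ξ (mem_ball_self _ _) M le_rfl

/-- The measure `P(η, ·, t)` may have an atom at `η`, but is absolutely continuous elsewhere. -/
theorem transition_null (ha : Antitone a) (ha_top : Tendsto a atTop (𝓝 0)) {t : ℝ} (ht : 0 ≤ t)
    {Z : Set (SB B)} (hZ : mu B Z = 0) {η : SB B} (hη : η ∉ Z) : transition a t η Z = 0 := by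
  have hsub : Z ⊆ ⋃ s ∈ {s ∈ cylinders B | η ∉ s}, Z ∩ s := by
    intro ξ hξ
    have hne : ∃ N, ξ ∉ ball η N := by
      by_contra! hc
      refine hη ((SB.ext' fun i => ?_ : ξ = η) ▸ hξ)
      exact hc (-(i + 1)) i (by omega)
    obtain ⟨N, hN⟩ := hne
    exact mem_iUnion₂.2 ⟨ball ξ N, ⟨cyl_mem_cylinders _ _, fun hc => hN (mem_ball_symm hc)⟩,
      hξ, mem_ball_self _ _⟩
  refine measure_mono_null hsub ?_
  rw [measure_biUnion_null_iff ((countable_cylinders B).mono fun s hs => hs.1)]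
  rintro _ ⟨⟨⟨ξ, k⟩, rfl⟩, h⟩
  dsimp only at h ⊢
  rw [cyl_eq_ball] at h ⊢
  obtain ⟨c, hc⟩ := transition_restrict_ball ha ha_top ht h
  rw [← Measure.restrict_apply' (measurableSet_ball _ _), hc, Measure.smul_apply,
    Measure.restrict_apply' (measurableSet_ball _ _), measure_mono_null inter_subset_left hZ,
    smul_zero]

theorem ae_transition_of_ae (ha : Antitone a) (ha_top : Tendsto a atTop (𝓝 0)) {t : ℝ}
    (ht : 0 ≤ t) {f g : SB B → ℝ} (h : f =ᵐ[mu B] g) :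
    ∀ᵐ η ∂(mu B), f =ᵐ[transition a t η] g := by
  filter_upwards [h] with η hη
  exact transition_null ha ha_top ht (ae_iff.1 h) fun hc => hc hη

/-! ### The operators `T a t` -/

/-- The elements of `L²` on which `T a t` is given by the kernel without a junk value. -/
structure IsTame (a : ℤ → ℝ) (t : ℝ) (f : L2 B) : Prop where
  integrable : ∀ᵐ η ∂(mu B), Integrable f (transition a t η)
  memLp : MemLp (markovOp a t f) 2 (mu B)

theorem IsTame.coeFn_T {t : ℝ} {f : L2 B} (hf : IsTame a t f) :
    T a t f =ᵐ[mu B] markovOp a t f := by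
  rw [T, dif_pos hf.memLp]
  exact hf.memLp.coeFn_toLp

theorem markovOp_add_ae (ha : Antitone a) (ha_top : Tendsto a atTop (𝓝 0)) {t : ℝ} (ht : 0 ≤ t)
    {f g : L2 B} (hf : IsTame a t f) (hg : IsTame a t g) :
    (∀ᵐ η ∂(mu B), Integrable (f + g : L2 B) (transition a t η)) ∧
      markovOp a t (f + g : L2 B) =ᵐ[mu B] markovOp a t f + markovOp a t g := by
  have h := ae_transition_of_ae ha ha_top ht (Lp.coeFn_add f g)
  constructor
  · filter_upwards [h, hf.integrable, hg.integrable] with η h1 h2 h3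
    exact (h2.add h3).congr h1.symm
  · filter_upwards [h, hf.integrable, hg.integrable] with η h1 h2 h3
    exact (integral_congr_ae h1).trans (integral_add h2 h3)

theorem IsTame.add (ha : Antitone a) (ha_top : Tendsto a atTop (𝓝 0)) {t : ℝ} (ht : 0 ≤ t)
    {f g : L2 B} (hf : IsTame a t f) (hg : IsTame a t g) : IsTame a t (f + g) := by
  obtain ⟨h1, h2⟩ := markovOp_add_ae ha ha_top ht hf hg
  exact ⟨h1, (hf.memLp.add hg.memLp).ae_eq h2.symm⟩

theorem IsTame.T_add (ha : Antitone a) (ha_top : Tendsto a atTop (𝓝 0)) {t : ℝ} (ht : 0 ≤ t)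
    {f g : L2 B} (hf : IsTame a t f) (hg : IsTame a t g) : T a t (f + g) = T a t f + T a t g := by
  refine Lp.ext ?_
  filter_upwards [(hf.add ha ha_top ht hg).coeFn_T, hf.coeFn_T, hg.coeFn_T,
    Lp.coeFn_add (T a t f) (T a t g), (markovOp_add_ae ha ha_top ht hf hg).2] with η h1 h2 h3 h4 h5
  rw [h1, h4, h5, Pi.add_apply, Pi.add_apply, h2, h3]

theorem markovOp_smul_ae (ha : Antitone a) (ha_top : Tendsto a atTop (𝓝 0)) {t : ℝ} (ht : 0 ≤ t)
    (c : ℝ) {f : L2 B} (hf : IsTame a t f) :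
    (∀ᵐ η ∂(mu B), Integrable (c • f : L2 B) (transition a t η)) ∧
      markovOp a t (c • f : L2 B) =ᵐ[mu B] c • markovOp a t f := by
  have h := ae_transition_of_ae ha ha_top ht (Lp.coeFn_smul c f)
  constructor
  · filter_upwards [h, hf.integrable] with η h1 h2
    exact (h2.smul c).congr h1.symm
  · filter_upwards [h] with η h1
    exact (integral_congr_ae h1).trans (integral_smul c f)

theorem IsTame.smul (ha : Antitone a) (ha_top : Tendsto a atTop (𝓝 0)) {t : ℝ} (ht : 0 ≤ t)
    (c : ℝ) {f : L2 B} (hf : IsTame a t f) : IsTame a t (c • f) := by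
  obtain ⟨h1, h2⟩ := markovOp_smul_ae ha ha_top ht c hf
  exact ⟨h1, (hf.memLp.const_smul c).ae_eq h2.symm⟩

theorem IsTame.T_smul (ha : Antitone a) (ha_top : Tendsto a atTop (𝓝 0)) {t : ℝ} (ht : 0 ≤ t)
    (c : ℝ) {f : L2 B} (hf : IsTame a t f) : T a t (c • f) = c • T a t f := by
  refine Lp.ext ?_
  filter_upwards [(hf.smul ha ha_top ht c).coeFn_T, hf.coeFn_T, Lp.coeFn_smul c (T a t f),
    (markovOp_smul_ae ha ha_top ht c hf).2] with η h1 h2 h3 h4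
  rw [h1, h3, h4, Pi.smul_apply, Pi.smul_apply, h2]

theorem isTame_zero (ha : Antitone a) (ha_top : Tendsto a atTop (𝓝 0)) {t : ℝ} (ht : 0 ≤ t) :
    IsTame a t (0 : L2 B) := by
  have h := ae_transition_of_ae ha ha_top ht (Lp.coeFn_zero ℝ 2 (mu B))
  constructor
  · filter_upwards [h] with η h1
    exact (integrable_zero _ _ _).congr h1.symm
  · refine MemLp.zero.ae_eq (f := fun _ => (0 : ℝ)) ?_
    filter_upwards [h] with η h1
    exact ((integral_congr_ae h1).trans (integral_zero' _ _)).symm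

theorem isTame_sum {ι : Type*} (s : Finset ι) (ha : Antitone a) (ha_top : Tendsto a atTop (𝓝 0))
    {t : ℝ} (ht : 0 ≤ t) (c : ι → ℝ) {f : ι → L2 B} (hf : ∀ i, IsTame a t (f i)) :
    IsTame a t (∑ i ∈ s, c i • f i) ∧ T a t (∑ i ∈ s, c i • f i) = ∑ i ∈ s, c i • T a t (f i) := by
  classical
  induction s using Finset.induction_on with
  | empty =>
    have h0 := isTame_zero (B := B) ha ha_top ht
    refine ⟨by simpa using h0, ?_⟩
    have := h0.T_smul ha ha_top ht 0
    simpa using this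
  | insert i s hi ih =>
    have hi' := (hf i).smul ha ha_top ht (c i)
    rw [Finset.sum_insert hi, Finset.sum_insert hi]
    exact ⟨hi'.add ha ha_top ht ih.1,
      by rw [hi'.T_add ha ha_top ht ih.1, ih.2, (hf i).T_smul ha ha_top ht]⟩

/-! ### Indicator functions of balls -/

theorem chiBall_coeFn (α : SB B) (M : ℤ) :
    chiBall α M =ᵐ[mu B] (ball α M).indicator fun _ => (1 : ℝ) :=
  indicatorConstLp_coeFn

theorem chiChild_eq_chiBall (M : ℤ) (α : SB B) (γ : Fin (α.branch (-(M + 2)))) :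
    chiChild M α γ = chiBall (childBall α M γ) M := by
  unfold chiChild chiBall
  congr 1
  exact child_eq_ball α M γ

theorem inner_chiBall (α : SB B) (M : ℤ) (f : L2 B) :
    inner ℝ (chiBall α M) f = ∫ ξ in ball α M, f ξ ∂(mu B) :=
  L2.inner_indicatorConstLp_one _ _ f

theorem inner_chiBall_chiBall (α β : SB B) (M N : ℤ) :
    inner ℝ (chiBall α M) (chiBall β N) = (mu B).real (ball β N ∩ ball α M) := by
  rw [inner_chiBall]
  unfold chiBall
  rw [setIntegral_indicatorConstLp (measurableSet_ball α M)]
  simp [ball]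

theorem inner_chiBall_self (α : SB B) (M : ℤ) :
    inner ℝ (chiBall α M) (chiBall α M) = ballMass α M := by
  rw [inner_chiBall_chiBall, inter_self, ballMass]

theorem disjoint_ball {α β : SB B} {M N : ℤ} (hNM : N ≤ M) (h : β ∉ ball α M) :
    ball β N ∩ ball α M = ∅ := by
  refine eq_empty_of_forall_notMem fun ξ hξ => h ?_
  rw [← ball_eq_of_mem hξ.2]
  exact mem_ball_symm (mem_ball_of_le hξ.1 hNM)

theorem chiBall_ne_zero (α : SB B) (M : ℤ) : chiBall α M ≠ 0 := by
  intro h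
  have h1 := inner_chiBall_self α M
  rw [h, inner_zero_left] at h1
  exact (ballMass_pos α M).ne h1

theorem ballProb_congr_left (a : ℤ → ℝ) {η η' β : SB B} {M : ℤ} (h : η' ∈ ball η M) (t : ℝ) :
    ballProb a η' β M t = ballProb a η β M t := by
  by_cases hM : β ∈ ball η M
  · rw [ballProb_of_mem a hM, ballProb_of_mem a (by rwa [ball_eq_of_mem h]),
      stayProb_congr a (mem_ball_of_le h (by omega))]
  · obtain ⟨N, h1, h2, h3⟩ := exists_sphere hM
    rw [ballProb_of_sphere a h1 h2 h3, ballProb_of_sphere a h1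
      (by rwa [ball_eq_of_mem (mem_ball_of_le h h1.le)])
      (by rwa [ball_eq_of_mem (mem_ball_of_le h (by omega : M ≤ N - 1))]),
      excess_congr a (mem_ball_of_le h h1.le)]

theorem continuous_ballProb (a : ℤ → ℝ) (β : SB B) (M : ℤ) (t : ℝ) :
    Continuous fun η => ballProb a η β M t := by
  refine continuous_def.2 fun U _ η hη => ⟨-(M + 1), fun η' h => ?_⟩
  rw [mem_preimage] at hη ⊢
  rwa [ballProb_congr_left a h]

theorem exists_ballProb_le (ha : Antitone a) (ha_top : Tendsto a atTop (𝓝 0)) (η β : SB B)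
    (M : ℤ) {t : ℝ} (ht : 0 ≤ t) :
    ∃ n : ℕ, η ∈ ball β (M + n) ∧ ballProb a η β M t ≤ massRatio β M n := by
  by_cases h : β ∈ ball η M
  · refine ⟨0, by simpa using mem_ball_symm h, ?_⟩
    rw [ballProb_of_mem a h, massRatio_zero]
    exact stayProb_le_one ha ha_top η M ht
  · obtain ⟨N, h1, h2, h3⟩ := exists_sphere h
    obtain ⟨n, rfl⟩ : ∃ n : ℕ, N = M + n := ⟨(N - M).toNat, by omega⟩
    refine ⟨n, mem_ball_symm h2, ?_⟩
    rw [ballProb_of_sphere a h1 h2 h3]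
    exact mul_le_of_le_one_right (massRatio_pos _ _ _).le (excess_le_one ha ha_top _ _ ht)

theorem memLp_ballProb (ha : Antitone a) (ha_top : Tendsto a atTop (𝓝 0)) (β : SB B) (M : ℤ)
    {t : ℝ} (ht : 0 ≤ t) : MemLp (fun η => ballProb a η β M t) 2 (mu B) := by
  have hmeas := (continuous_ballProb a β M t).measurable.aestronglyMeasurable (μ := mu B)
  rw [memLp_two_iff_integrable_sq hmeas]
  refine ⟨hmeas.pow 2, ?_⟩
  have hbound : ∀ η, ‖ballProb a η β M t ^ 2‖ₑ ≤ ∑' n : ℕ,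
      (ball β (M + n)).indicator (fun _ => ENNReal.ofReal (massRatio β M n ^ 2)) η := by
    intro η
    obtain ⟨n, h1, h2⟩ := exists_ballProb_le ha ha_top η β M ht
    refine le_trans ?_ (ENNReal.le_tsum n)
    rw [indicator_of_mem h1, Real.enorm_of_nonneg (sq_nonneg _)]
    exact ENNReal.ofReal_le_ofReal (pow_le_pow_left₀ (ballProb_nonneg ha ha_top _ _ _ ht) h2 2)
  refine (lintegral_mono hbound).trans_lt ?_
  rw [lintegral_tsum fun n => (measurable_const.indicator (measurableSet_ball _ _)).aemeasurable]
  have hterm : ∀ n : ℕ, ∫⁻ η, (ball β (M + n)).indicator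
      (fun _ => ENNReal.ofReal (massRatio β M n ^ 2)) η ∂(mu B) =
      ENNReal.ofReal (massRatio β M n * ballMass β M) := by
    intro n
    rw [lintegral_indicator_const (measurableSet_ball _ _), mu_ball_eq,
      ← ENNReal.ofReal_mul (sq_nonneg _)]
    congr 1
    have := ballMass_pos β (M + n)
    rw [massRatio]
    field_simp
  simp only [hterm]
  refine (Summable.tsum_ofReal_ne_top ?_).lt_top
  refine Summable.mul_right _ (Summable.of_nonneg_of_le (fun n => (massRatio_pos _ _ _).le)
    (massRatio_le β M) (summable_geometric_of_lt_one (by norm_num) (by norm_num)))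

theorem markovOp_chiBall (ha : Antitone a) (ha_top : Tendsto a atTop (𝓝 0)) (β : SB B) (M : ℤ)
    {t : ℝ} (ht : 0 ≤ t) :
    (∀ᵐ η ∂(mu B), Integrable (chiBall β M) (transition a t η)) ∧
      markovOp a t (chiBall β M) =ᵐ[mu B] fun η => ballProb a η β M t := by
  have h := ae_transition_of_ae ha ha_top ht (chiBall_coeFn β M)
  constructor
  · filter_upwards [h] with η h1
    refine Integrable.congr ?_ h1.symm
    rw [integrable_indicator_iff (measurableSet_ball _ _)]
    refine integrableOn_const ?_
    rw [transition_ball ha ha_top η β M ht]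
    exact ENNReal.ofReal_ne_top
  · filter_upwards [h] with η h1
    rw [markovOp, integral_congr_ae h1, integral_indicator_const _ (measurableSet_ball _ _),
      Measure.real, transition_ball ha ha_top η β M ht,
      ENNReal.toReal_ofReal (ballProb_nonneg ha ha_top _ _ _ ht), smul_eq_mul, mul_one]

theorem isTame_chiBall (ha : Antitone a) (ha_top : Tendsto a atTop (𝓝 0)) (β : SB B) (M : ℤ)
    {t : ℝ} (ht : 0 ≤ t) : IsTame a t (chiBall β M) :=
  ⟨(markovOp_chiBall ha ha_top β M ht).1,
    (memLp_ballProb ha ha_top β M ht).ae_eq (markovOp_chiBall ha ha_top β M ht).2.symm⟩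

theorem T_chiBall_coeFn (ha : Antitone a) (ha_top : Tendsto a atTop (𝓝 0)) (β : SB B) (M : ℤ)
    {t : ℝ} (ht : 0 ≤ t) :
    T a t (chiBall β M) =ᵐ[mu B] fun η => ballProb a η β M t :=
  (isTame_chiBall ha ha_top β M ht).coeFn_T.trans (markovOp_chiBall ha ha_top β M ht).2

theorem coeFn_sum_smul {ι : Type*} (s : Finset ι) (c : ι → ℝ) (f : ι → L2 B) {F : ι → SB B → ℝ}
    (hF : ∀ i, f i =ᵐ[mu B] F i) :
    (∑ i ∈ s, c i • f i : L2 B) =ᵐ[mu B] fun η => ∑ i ∈ s, c i * F i η := by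
  classical
  induction s using Finset.induction_on with
  | empty =>
    filter_upwards [Lp.coeFn_zero ℝ 2 (mu B)] with η h
    simpa using h
  | insert i s hi ih =>
    rw [Finset.sum_insert hi]
    filter_upwards [ih, hF i, Lp.coeFn_add (c i • f i) (∑ j ∈ s, c j • f j),
      Lp.coeFn_smul (c i) (f i)] with η h1 h2 h3 h4
    rw [h3, Pi.add_apply, h1, h4, Pi.smul_apply, h2, Finset.sum_insert hi, smul_eq_mul]

/-- The key computation: on the children of `{α}_{-(M+2)}`, the kernel is `exp (-h_{M,α} t)` times
the identity up to a term that does not depend on the child. -/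
theorem exists_ballProb_childBall_eq (ha : Antitone a) (ha_top : Tendsto a atTop (𝓝 0))
    (α η : SB B) (M : ℤ) {t : ℝ} (ht : 0 ≤ t) :
    ∃ c : ℝ, ∀ γ, ballProb a η (childBall α M γ) M t =
      c + Real.exp (-(hEig a M α) * t) *
        (ball (childBall α M γ) M).indicator (fun _ => (1 : ℝ)) η := by
  by_cases h : η ∈ ball α (M + 1)
  · obtain ⟨γ₀, hγ₀⟩ := exists_childBall h
    refine ⟨(α.branch (-(M + 2)) : ℝ)⁻¹ * excess a α (M + 1) t, fun γ => ?_⟩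
    by_cases hγ : η ∈ ball (childBall α M γ) M
    · rw [indicator_of_mem hγ, ballProb_of_mem a (mem_ball_symm hγ),
        stayProb_eq_add ha ha_top η M ht, branch_congr h (by omega), excess, hEig_congr a h,
        stayProb_congr a (mem_ball_of_le h (by omega : M + 1 ≤ M + 1 + 1)), add_sub_cancel_right]
      ring
    · rw [indicator_of_notMem hγ, ballProb_sibling a h hγ, mul_zero, add_zero]
  · refine ⟨(α.branch (-(M + 2)) : ℝ)⁻¹ * ballProb a η α (M + 1) t, fun γ => ?_⟩
    rw [indicator_of_notMem (not_mem_childBall h γ), ballProb_outside a h, mul_zero, add_zero]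

theorem T_sum_chiChild (ha : Antitone a) (ha_top : Tendsto a atTop (𝓝 0)) (M : ℤ) (α : SB B)
    {b : Fin (α.branch (-(M + 2))) → ℝ} (hb : ∑ γ, b γ = 0) {t : ℝ} (ht : 0 ≤ t) :
    T a t (∑ γ, b γ • chiChild M α γ) =
      Real.exp (-(hEig a M α) * t) • ∑ γ, b γ • chiChild M α γ := by
  simp only [chiChild_eq_chiBall]
  rw [(isTame_sum Finset.univ ha ha_top ht b fun γ =>
    isTame_chiBall ha ha_top (childBall α M γ) M ht).2]
  refine Lp.ext ?_
  filter_upwards [coeFn_sum_smul Finset.univ b _ fun γ =>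
      T_chiBall_coeFn ha ha_top (childBall α M γ) M ht,
    coeFn_sum_smul Finset.univ b _ fun γ => chiBall_coeFn (childBall α M γ) M,
    Lp.coeFn_smul (Real.exp (-(hEig a M α) * t)) (∑ γ, b γ • chiBall (childBall α M γ) M)]
    with η h1 h2 h3
  obtain ⟨c, hc⟩ := exists_ballProb_childBall_eq ha ha_top α η M ht
  rw [h1, h3, Pi.smul_apply, h2, smul_eq_mul, Finset.mul_sum]
  simp only [hc, mul_add, Finset.sum_add_distrib, ← Finset.sum_mul, hb, zero_mul, zero_add]
  exact Finset.sum_congr rfl fun γ _ => by ring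

/-! ### The generator -/

theorem tendsto_one_sub_exp (r : ℝ) :
    Tendsto (fun t : ℝ => t⁻¹ * (1 - Real.exp (-r * t))) (𝓝[>] 0) (𝓝 r) := by
  have h1 : HasDerivAt (fun t : ℝ => -Real.exp (-r * t)) r 0 := by
    refine HasDerivAt.congr_deriv (((hasDerivAt_id (0 : ℝ)).const_mul (-r)).exp.fun_neg) ?_
    simp
  have h2 := h1.tendsto_slope_zero_right
  refine h2.congr fun t => ?_
  rw [smul_eq_mul, zero_add, mul_zero, Real.exp_zero]
  ring

theorem hasH_of_T_eq {f : L2 B} {r : ℝ} (h : ∀ t > 0, T a t f = Real.exp (-r * t) • f) :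
    HasH a f (r • f) := by
  refine ((tendsto_one_sub_exp r).smul_const f).congr' ?_
  filter_upwards [self_mem_nhdsWithin] with t ht
  rw [h t ht, mul_smul, sub_smul, one_smul]

theorem hasH_eVectors (ha : Antitone a) (ha_top : Tendsto a atTop (𝓝 0)) (M : ℤ) (α : SB B)
    {f : L2 B} (hf : f ∈ eVectors M α) : HasH a f (hEig a M α • f) := by
  obtain ⟨b, hb, rfl⟩ := hf
  exact hasH_of_T_eq fun t ht => T_sum_chiChild ha ha_top M α hb ht.le

theorem isEigenvector_chiBall (ha : Antitone a) (ha_top : Tendsto a atTop (𝓝 0)) {M : ℤ}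
    (α : SB B) (hM : a M = 0) : IsEigenvector a 0 (chiBall α M) := by
  refine ⟨chiBall_ne_zero α M, hasH_of_T_eq fun t ht => ?_⟩
  rw [neg_zero, zero_mul, Real.exp_zero, one_smul]
  have ha0 : ∀ N, M ≤ N → a N = 0 := fun N hN =>
    le_antisymm (hM ▸ ha hN) (nonneg_of_antitone ha ha_top N)
  have hstay : ∀ (η : SB B) N, M ≤ N → stayProb a η N t = 1 := fun η N hN => by
    refine le_antisymm (stayProb_le_one ha ha_top η N ht.le) ?_
    have := exp_le_stayProb ha ha_top η N ht.le
    rwa [ha0 N hN, neg_zero, zero_mul, Real.exp_zero] at this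
  refine Lp.ext ?_
  filter_upwards [T_chiBall_coeFn ha ha_top α M ht.le, chiBall_coeFn α M] with η h1 h2
  rw [h1, h2]
  by_cases h : α ∈ ball η M
  · rw [indicator_of_mem (mem_ball_symm h), ballProb_of_mem a h, hstay η M le_rfl]
  · rw [indicator_of_notMem fun hc => h (mem_ball_symm hc)]
    obtain ⟨N, h3, h4, h5⟩ := exists_sphere h
    rw [ballProb_of_sphere a h3 h4 h5, excess, hstay η N h3.le, hEig_eq, ha0 _ (by omega),
      ha0 _ (by omega)]
    simp

/-! ### Eigenfunctions among the indicators of balls -/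

theorem excess_of_hasH_chiBall (ha : Antitone a) (ha_top : Tendsto a atTop (𝓝 0)) {K : ℤ}
    {α : SB B} {r : ℝ} (h : HasH a (chiBall α K) (r • chiBall α K)) {N : ℤ} (hN : K ≤ N) :
    Tendsto (fun t : ℝ => t⁻¹ * excess a α (N + 1) t) (𝓝[>] 0) (𝓝 0) := by
  -- Test against the indicator of a sibling of the ball `{α}_{-(N+1)}`.
  obtain ⟨γ₀, hγ₀⟩ := exists_childBall (mem_ball_self α (N + 1))
  have h2b := α.two_le_branch (-(N + 2))
  have : Nontrivial (Fin (α.branch (-(N + 2)))) := Fin.nontrivial_iff_two_le.2 h2b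
  obtain ⟨γ, hγ⟩ := exists_ne γ₀
  set β := childBall α N γ with hβ
  have hβα : α ∉ ball β N := fun hc => hγ ((hγ₀ γ).1 hc)
  have hmem : β ∈ ball α (N + 1) := childBall_mem α N γ
  have h0 : inner ℝ (chiBall β N) (chiBall α K) = 0 := by
    rw [inner_chiBall_chiBall, disjoint_ball hN hβα]
    simp
  have hT : ∀ t : ℝ, 0 < t → inner ℝ (chiBall β N) (T a t (chiBall α K)) =
      (ballMass β N * (ballMass α K / ballMass α (N + 1))) * excess a α (N + 1) t := by
    intro t ht
    rw [inner_chiBall]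
    have hc : ∀ᵐ η ∂(mu B), η ∈ ball β N → T a t (chiBall α K) η =
        ballMass α K / ballMass α (N + 1) * excess a α (N + 1) t := by
      filter_upwards [T_chiBall_coeFn ha ha_top α K ht.le] with η h1 h2
      have h3 : η ∈ ball α (N + 1) := by
        rw [← ball_eq_of_mem hmem]
        exact mem_ball_of_le h2 (by omega)
      rw [h1, ballProb_of_sphere a (N := N + 1) (by omega) (mem_ball_symm h3) (fun hc => hβα <| by
        rw [← ball_eq_of_mem h2]
        simpa using hc), excess_congr a h3]
    rw [setIntegral_congr_ae (measurableSet_ball _ _) hc, setIntegral_const, smul_eq_mul,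
      ← mul_assoc]
    rfl
  have hlim : Tendsto (fun t : ℝ => inner ℝ (chiBall β N)
      (t⁻¹ • (chiBall α K - T a t (chiBall α K)))) (𝓝[>] 0) (𝓝 0) := by
    have := (tendsto_const_nhds (x := chiBall β N)).inner (𝕜 := ℝ) h
    rwa [inner_smul_right, h0, mul_zero] at this
  set C := ballMass β N * (ballMass α K / ballMass α (N + 1)) with hC
  have hCpos : 0 < C := mul_pos (ballMass_pos _ _) (div_pos (ballMass_pos _ _) (ballMass_pos _ _))
  have hlim' := hlim.const_mul (-C⁻¹)
  rw [mul_zero] at hlim'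
  refine hlim'.congr' ?_
  filter_upwards [self_mem_nhdsWithin] with t ht
  rw [inner_smul_right, inner_sub_right, h0, hT t ht]
  field_simp
  ring

/-- If the indicator of a ball is an eigenfunction, then `a` vanishes from the radius of the ball
onwards: on the sphere `{α}_{-(N+2)} \ {α}_{-(N+1)}` outside the ball, `H` of the indicator is
`h_{N,α} - a (N + 1)` up to a nonzero factor. -/
theorem eq_zero_of_hasH_chiBall (ha : Antitone a) (ha_top : Tendsto a atTop (𝓝 0)) {K : ℤ}
    {α : SB B} {r : ℝ} (h : HasH a (chiBall α K) (r • chiBall α K)) : a K = 0 := by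
  have hstep : ∀ N, K ≤ N → a N ≤ a (N + 1) := by
    intro N hN
    have h1 := excess_of_hasH_chiBall ha ha_top h hN
    have h2 := (tendsto_one_sub_exp (hEig a N α)).sub (tendsto_one_sub_exp (a (N + 1)))
    have h3 := le_of_tendsto_of_tendsto h2 h1 (by
      filter_upwards [self_mem_nhdsWithin] with t (ht : 0 < t)
      have h4 := exp_sub_exp_le_excess ha ha_top α (N + 1) ht.le
      rw [add_sub_cancel_right] at h4
      rw [← mul_sub]
      exact mul_le_mul_of_nonneg_left (by linarith) (inv_pos.2 ht).le)
    linarith [le_hEig ha N α]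
  have hall : ∀ N, K ≤ N → a K ≤ a N := by
    intro N hN
    induction N, hN using Int.leInduction with
    | base => exact le_rfl
    | succ N hN ih => exact ih.trans (hstep N hN)
  refine le_antisymm (ge_of_tendsto ha_top ?_) (nonneg_of_antitone ha ha_top K)
  filter_upwards [eventually_ge_atTop K] with N hN using hall N hN

theorem HasH.unique {f g g' : L2 B} (h : HasH a f g) (h' : HasH a f g') : g = g' :=
  tendsto_nhds_unique h h'

theorem not_hasH_chiBall (ha : Antitone a) (ha_top : Tendsto a atTop (𝓝 0)) {K : ℤ}
    {α : SB B} {r : ℝ} (hr : r ≠ 0) : ¬ HasH a (chiBall α K) (r • chiBall α K) := by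
  intro h
  have h1 := (isEigenvector_chiBall ha ha_top α (eq_zero_of_hasH_chiBall ha ha_top h)).2
  have h2 := h.unique h1
  rw [zero_smul] at h2
  exact (smul_ne_zero hr (chiBall_ne_zero α K)) h2

/-! ### The eigenspaces -/

/-- The linear map `b ↦ ∑ b_γ χ_{{α}_{-(M+2)} × {γ}}`. -/
def childComb (M : ℤ) (α : SB B) : (Fin (α.branch (-(M + 2))) → ℝ) →ₗ[ℝ] L2 B :=
  Fintype.linearCombination ℝ fun γ : Fin (α.branch (-(M + 2))) => chiChild M α γ

theorem childComb_apply (M : ℤ) (α : SB B) (b : Fin (α.branch (-(M + 2))) → ℝ) :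
    childComb M α b = ∑ γ, b γ • chiChild M α γ := rfl

/-- The linear functional `b ↦ ∑ b_γ`. -/
def coeffSum (n : ℕ) : (Fin n → ℝ) →ₗ[ℝ] ℝ := ∑ γ, LinearMap.proj γ

theorem coeffSum_apply {n : ℕ} (b : Fin n → ℝ) : coeffSum n b = ∑ γ, b γ := by
  simp [coeffSum]

theorem eVectors_eq_map (M : ℤ) (α : SB B) :
    eVectors M α = ((LinearMap.ker (coeffSum (α.branch (-(M + 2))))).map (childComb M α) :
      Submodule ℝ (L2 B)) := by
  ext f
  simp only [eVectors, Submodule.map_coe, mem_image, SetLike.mem_coe, LinearMap.mem_ker,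
    coeffSum_apply, childComb_apply]
  exact ⟨fun ⟨b, h1, h2⟩ => ⟨b, h1, h2.symm⟩, fun ⟨b, h1, h2⟩ => ⟨b, h1, h2.symm⟩⟩

theorem span_eVectors (M : ℤ) (α : SB B) : Submodule.span ℝ (eVectors M α) =
    (LinearMap.ker (coeffSum (α.branch (-(M + 2))))).map (childComb M α) := by
  rw [eVectors_eq_map, Submodule.span_eq]

theorem mem_span_eVectors_iff {M : ℤ} {α : SB B} {f : L2 B} :
    f ∈ Submodule.span ℝ (eVectors M α) ↔ f ∈ eVectors M α := by
  rw [span_eVectors, ← SetLike.mem_coe, ← eVectors_eq_map]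

theorem childComb_injective (M : ℤ) (α : SB B) : Function.Injective (childComb M α) := by
  rw [← LinearMap.ker_eq_bot, LinearMap.ker_eq_bot']
  intro b hb
  funext γ₀
  have h1 : inner ℝ (chiBall (childBall α M γ₀) M) (childComb M α b) =
      b γ₀ * ballMass (childBall α M γ₀) M := by
    simp only [childComb_apply, chiChild_eq_chiBall, inner_sum, inner_smul_right]
    rw [Finset.sum_eq_single γ₀, inner_chiBall_self]
    · intro γ _ hγ
      rw [inner_chiBall_chiBall, disjoint_ball le_rfl, measureReal_empty, mul_zero]
      intro hc
      obtain ⟨γ₁, hγ₁⟩ := exists_childBall (childBall_mem α M γ)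
      exact hγ (((hγ₁ γ).1 (mem_ball_self _ _)).trans ((hγ₁ γ₀).1 hc).symm)
    · exact fun h => absurd (Finset.mem_univ _) h
  rw [hb, inner_zero_right] at h1
  exact (mul_eq_zero.1 h1.symm).resolve_right (ballMass_pos _ _).ne'

theorem finrank_span_eVectors (M : ℤ) (α : SB B) :
    Module.finrank ℝ (Submodule.span ℝ (eVectors M α)) = α.branch (-(M + 2)) - 1 := by
  rw [span_eVectors, ← (Submodule.equivMapOfInjective _ (childComb_injective M α) _).finrank_eq]
  have hpos : 0 < α.branch (-(M + 2)) := lt_of_lt_of_le (by norm_num) (α.two_le_branch _)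
  have hne : coeffSum (α.branch (-(M + 2))) ≠ 0 := by
    intro h
    have := LinearMap.congr_fun h (Pi.single ⟨0, hpos⟩ 1)
    rw [coeffSum_apply] at this
    simp at this
  have h1 := Module.Dual.finrank_ker_add_one_of_ne_zero (f := coeffSum (α.branch (-(M + 2)))) hne
  rw [Module.finrank_fin_fun] at h1
  omega

theorem sub_chiChild_mem_eVectors (M : ℤ) (α : SB B) (γ γ' : Fin (α.branch (-(M + 2)))) :
    (chiChild M α γ - chiChild M α γ' : L2 B) ∈ eVectors M α := by
  refine ⟨Pi.single γ 1 - Pi.single γ' 1, by simp, ?_⟩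
  rw [← childComb_apply, map_sub]
  simp [childComb, Fintype.linearCombination_apply_single]

theorem exists_ne_zero_mem_eVectors (M : ℤ) (α : SB B) : ∃ f ∈ eVectors M α, f ≠ 0 := by
  have : Nontrivial (Fin (α.branch (-(M + 2)))) :=
    Fin.nontrivial_iff_two_le.2 (α.two_le_branch _)
  obtain ⟨γ, γ', hne⟩ := exists_pair_ne (Fin (α.branch (-(M + 2))))
  refine ⟨_, sub_chiChild_mem_eVectors M α γ γ', fun h => hne ?_⟩
  have h1 : childComb M α (Pi.single γ 1) = childComb M α (Pi.single γ' 1) := by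
    simpa [childComb, Fintype.linearCombination_apply_single] using sub_eq_zero.1 h
  have h2 := congr_fun (childComb_injective M α h1) γ
  by_contra hc
  simp [hc] at h2

theorem sum_chiChild (M : ℤ) (α : SB B) :
    (∑ γ : Fin (α.branch (-(M + 2))), chiChild M α γ : L2 B) = chiBall α (M + 1) := by
  have h : (∑ γ : Fin (α.branch (-(M + 2))), chiChild M α γ : L2 B) =
      ∑ γ, (1 : ℝ) • chiBall (childBall α M γ) M := by
    simp only [chiChild_eq_chiBall, one_smul]
  rw [h]
  refine Lp.ext ?_
  filter_upwards [coeFn_sum_smul Finset.univ (fun _ => (1 : ℝ)) _ fun γ =>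
    chiBall_coeFn (childBall α M γ) M, chiBall_coeFn α (M + 1)] with η h1 h2
  rw [h1, h2]
  by_cases hη : η ∈ ball α (M + 1)
  · obtain ⟨γ₀, hγ₀⟩ := exists_childBall hη
    rw [Finset.sum_eq_single γ₀, indicator_of_mem ((hγ₀ γ₀).2 rfl), indicator_of_mem hη, one_mul]
    · intro γ _ hγ
      rw [indicator_of_notMem fun hc => hγ ((hγ₀ γ).1 hc), mul_zero]
    · exact fun h => absurd (Finset.mem_univ _) h
  · rw [indicator_of_notMem hη]
    exact Finset.sum_eq_zero fun γ _ => by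
      rw [indicator_of_notMem (not_mem_childBall hη γ), mul_zero]

/-- A combination of indicators of siblings that is an eigenfunction to `h_{M,α}` has coefficient
sum `0`: otherwise the indicator of the parent ball would be an eigenfunction too. -/
theorem mem_eVectors_of_hasH (ha : Antitone a) (ha_top : Tendsto a atTop (𝓝 0)) {M : ℤ} {α : SB B}
    (hM : 0 < a M) {c : Fin (α.branch (-(M + 2))) → ℝ}
    (h : HasH a (childComb M α c) (hEig a M α • childComb M α c)) :
    childComb M α c ∈ eVectors M α := by
  set m : ℝ := (α.branch (-(M + 2)) : ℝ)⁻¹ * ∑ γ, c γ with hm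
  have hb := branch_pos α (-(M + 2))
  have hr : hEig a M α ≠ 0 := (hM.trans_le (le_hEig ha M α)).ne'
  have hsum : ∑ γ, (c γ - m) = 0 := by
    rw [Finset.sum_sub_distrib, Finset.sum_const, Finset.card_univ, Fintype.card_fin,
      nsmul_eq_mul, hm]
    field_simp
    ring
  set e : L2 B := ∑ γ, (c γ - m) • chiChild M α γ with he
  have hdecomp : childComb M α c = e + m • chiBall α (M + 1) := by
    rw [childComb_apply, he, ← sum_chiChild, Finset.smul_sum, ← Finset.sum_add_distrib]
    exact Finset.sum_congr rfl fun γ _ => by rw [← add_smul, sub_add_cancel]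
  have heE : e ∈ eVectors M α := ⟨_, hsum, rfl⟩
  by_cases hm0 : m = 0
  · rw [hdecomp, hm0, zero_smul, add_zero]
    exact heE
  · exfalso
    refine not_hasH_chiBall ha ha_top (K := M + 1) (α := α) hr ?_
    have hchi : chiBall α (M + 1) = m⁻¹ • (childComb M α c - e) := by
      rw [hdecomp, add_sub_cancel_left, inv_smul_smul₀ hm0]
    have hlim := (Tendsto.sub h (hasH_eVectors ha ha_top M α heE)).const_smul m⁻¹
    have hlim' : m⁻¹ • (hEig a M α • childComb M α c - hEig a M α • e) =
        hEig a M α • chiBall α (M + 1) := by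
      rw [hchi, ← smul_sub, smul_comm]
    rw [hlim'] at hlim
    refine hlim.congr' ?_
    filter_upwards [self_mem_nhdsWithin] with t (ht : 0 < t)
    have htame : IsTame a t e := by
      rw [he]
      simp only [chiChild_eq_chiBall]
      exact (isTame_sum Finset.univ ha ha_top ht.le _ fun γ =>
        isTame_chiBall ha ha_top (childBall α M γ) M ht.le).1
    have hchit := isTame_chiBall ha ha_top α (M + 1) ht.le
    have hT : T a t (childComb M α c) = T a t e + m • T a t (chiBall α (M + 1)) := by
      rw [hdecomp, htame.T_add ha ha_top ht.le (hchit.smul ha ha_top ht.le m),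
        hchit.T_smul ha ha_top ht.le]
    rw [← smul_sub, smul_comm, hT, hdecomp]
    congr 1
    rw [show e + m • chiBall α (M + 1) - (T a t e + m • T a t (chiBall α (M + 1))) - (e - T a t e) =
      m • (chiBall α (M + 1) - T a t (chiBall α (M + 1))) by rw [smul_sub]; abel,
      inv_smul_smul₀ hm0]

theorem span_eVectors_eq_kerH_inter (ha : Antitone a) (ha_top : Tendsto a atTop (𝓝 0)) {M : ℤ}
    (α : SB B) (hM : 0 < a M) :
    (Submodule.span ℝ (eVectors M α) : Set (L2 B)) = kerH B a (hEig a M α) ∩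
      Submodule.span ℝ (Set.range fun γ : Fin (α.branch (-(M + 2))) => chiChild M α γ) := by
  ext f
  rw [SetLike.mem_coe, mem_span_eVectors_iff, mem_inter_iff, SetLike.mem_coe,
    Submodule.mem_span_range_iff_exists_fun]
  constructor
  · intro hf
    refine ⟨hasH_eVectors ha ha_top M α hf, ?_⟩
    obtain ⟨b, -, rfl⟩ := hf
    exact ⟨b, rfl⟩
  · rintro ⟨h, c, rfl⟩
    exact mem_eVectors_of_hasH ha ha_top hM h

/-! ### Completeness of the eigenvectors -/

/-- If `g` is orthogonal to all vectors `e_{M,α}`, its mean over a ball does not change when the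
ball is replaced by its parent. -/
theorem inner_chiBall_succ {g : L2 B} (hg : ∀ (M : ℤ) (α : SB B), ∀ e ∈ eVectors M α,
    inner ℝ e g = 0) (α : SB B) (M : ℤ) :
    inner ℝ (chiBall α (M + 1)) g = α.branch (-(M + 2)) * inner ℝ (chiBall α M) g := by
  obtain ⟨γ₀, hγ₀⟩ := exists_childBall (mem_ball_self α (M + 1))
  have h1 : ∀ γ : Fin (α.branch (-(M + 2))),
      inner ℝ (chiChild M α γ) g = inner ℝ (chiChild M α γ₀) g := by
    intro γ
    have := hg M α _ (sub_chiChild_mem_eVectors M α γ γ₀)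
    rwa [inner_sub_left, sub_eq_zero] at this
  have h2 : inner ℝ (chiChild M α γ₀) g = inner ℝ (chiBall α M) g := by
    rw [chiChild_eq_chiBall, inner_chiBall, inner_chiBall, ball_eq_of_mem ((hγ₀ γ₀).2 rfl)]
  rw [← sum_chiChild, sum_inner, Finset.sum_congr rfl fun γ _ => (h1 γ).trans h2, Finset.sum_const,
    Finset.card_univ, Fintype.card_fin, nsmul_eq_mul]

theorem inner_chiBall_eq_zero {g : L2 B} (hg : ∀ (M : ℤ) (α : SB B), ∀ e ∈ eVectors M α,
    inner ℝ e g = 0) (α : SB B) (M : ℤ) : inner ℝ (chiBall α M) g = 0 := by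
  have hstep : ∀ n : ℕ, inner ℝ (chiBall α M) g =
      massRatio α M n * inner ℝ (chiBall α (M + n)) g := by
    intro n
    induction n with
    | zero => simp [massRatio_zero]
    | succ n ih =>
      rw [ih, massRatio_eq_mul α M n]
      push_cast
      rw [← add_assoc, inner_chiBall_succ hg]
      ring
  -- By Cauchy–Schwarz the right-hand side is `O(massRatio ^ (1/2))`.
  have hsq : ∀ n : ℕ, inner ℝ (chiBall α M) g ^ 2 ≤
      massRatio α M n * (ballMass α M * ‖g‖ ^ 2) := by
    intro n
    have h1 : inner ℝ (chiBall α (M + n)) g ^ 2 ≤ ballMass α (M + n) * ‖g‖ ^ 2 := by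
      rw [← inner_chiBall_self, ← sq_abs, real_inner_self_eq_norm_sq, ← mul_pow]
      exact pow_le_pow_left₀ (abs_nonneg _) (abs_real_inner_le_norm _ _) 2
    have h2 : massRatio α M n * ballMass α (M + n) = ballMass α M := by
      have := ballMass_pos α (M + n)
      rw [massRatio]
      field_simp
    rw [hstep n, mul_pow]
    refine (mul_le_mul_of_nonneg_left h1 (sq_nonneg _)).trans_eq ?_
    rw [← h2]
    ring
  have hlim : Tendsto (fun n => massRatio α M n * (ballMass α M * ‖g‖ ^ 2)) atTop (𝓝 0) := by
    simpa using (tendsto_massRatio α M).mul_const (ballMass α M * ‖g‖ ^ 2)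
  exact pow_eq_zero_iff two_ne_zero |>.1
    (le_antisymm (ge_of_tendsto' hlim hsq) (sq_nonneg _))

theorem eq_zero_of_inner_chiBall_eq_zero {g : L2 B} (hg : ∀ α M, inner ℝ (chiBall α M) g = 0) :
    g = 0 := by
  have hball : ∀ α M, g =ᵐ[(mu B).restrict (ball α M)] 0 := by
    intro α M
    have hint : IntegrableOn g (ball α M) (mu B) :=
      integrableOn_Lp_of_measure_ne_top g (by norm_num) (mu_cyl_ne_top α _)
    refine Integrable.ae_eq_zero_of_forall_setIntegral_eq_zero hint fun s hs _ => ?_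
    have hzero : ∀ β N, ∫ ξ in ball β N, g ξ ∂(mu B) = 0 := fun β N => by
      rw [← inner_chiBall, hg]
    induction s, hs using MeasurableSpace.induction_on_inter
      (measurableSpace_eq_generateFrom_cylinders B) (isPiSystem_cylinders B) with
    | empty => simp
    | basic s hs =>
      obtain ⟨⟨β, k⟩, rfl⟩ := hs
      dsimp only
      rw [Measure.restrict_restrict (measurableSet_cyl β k), cyl_eq_ball]
      rcases (ball β (-(k + 1)) ∩ ball α M).eq_empty_or_nonempty with h0 | ⟨ζ, hζ1, hζ2⟩
      · rw [h0, Measure.restrict_empty, integral_zero_measure]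
      · rw [← ball_eq_of_mem hζ1, ← ball_eq_of_mem hζ2, ball_inter_ball]
        exact hzero _ _
    | compl s hs ih =>
      have h1 := integral_add_compl hs hint
      rw [hzero] at h1
      have h2 := ih ((measure_lt_top_of_subset (subset_univ s) (by
        rw [Measure.restrict_apply_univ]
        exact mu_cyl_ne_top α _)))
      linarith
    | iUnion f hdisj hf ih =>
      rw [integral_iUnion hf hdisj hint.integrableOn]
      have h2 : ∀ i, (mu B).restrict (ball α M) (f i) < ∞ := fun i =>
        measure_lt_top_of_subset (subset_univ _) (by
          rw [Measure.restrict_apply_univ]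
          exact mu_cyl_ne_top α _)
      simp [ih _ (h2 _)]
  have hcover : ⋃ n : ℕ, ball (SB.zero B) n = univ := by
    refine eq_univ_of_forall fun ξ => ?_
    obtain ⟨N, hN⟩ := exists_mem_ball (SB.zero B) ξ
    exact mem_iUnion.2 ⟨N.toNat, hN _ (Int.self_le_toNat N)⟩
  have hae : g =ᵐ[(mu B).restrict univ] 0 := by
    rw [← hcover]
    exact (ae_restrict_iUnion_iff _ _).2 fun n => hball _ _
  rw [Measure.restrict_univ] at hae
  exact (Lp.eq_zero_iff_ae_eq_zero).2 hae

theorem dense_span_eVectors (B : BranchingFunction) :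
    Dense (Submodule.span ℝ (⋃ (M : ℤ) (α : SB B), eVectors M α) : Set (L2 B)) := by
  rw [Submodule.dense_iff_topologicalClosure_eq_top, Submodule.topologicalClosure_eq_top_iff,
    Submodule.eq_bot_iff]
  intro g hg
  refine eq_zero_of_inner_chiBall_eq_zero (inner_chiBall_eq_zero fun M α e he => ?_)
  exact (Submodule.mem_orthogonal _ _).1 hg e
    (Submodule.subset_span (mem_iUnion₂.2 ⟨M, α, he⟩))

end TreeLeaves

end

theorem theorem4p3 (B : BranchingFunction) (a : ℤ → ℝ) (W : EReal)
    (ha : Antitone a) (ha_top : Tendsto a atTop (𝓝 0))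
    (hW : 0 < W) (ha_bot : Tendsto (fun N : ℤ => (a N : EReal)) atBot (𝓝 W)) :
    -- (a), for `a(M) > 0`
    (∀ (M : ℤ) (α : SB B), 0 < a M →
      (∃ f : L2 B, IsEigenvector a (hEig a M α) f) ∧
      Module.finrank ℝ (Submodule.span ℝ (eVectors M α)) = α.branch (-(M + 2)) - 1 ∧
      (∀ f ∈ Submodule.span ℝ (eVectors M α), HasH a f (hEig a M α • f)) ∧
      (Submodule.span ℝ (eVectors M α) : Set (L2 B)) =
        kerH B a (hEig a M α) ∩
          Submodule.span ℝ (Set.range fun γ : Fin (α.branch (-(M + 2))) => chiChild M α γ)) ∧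
    -- (a), for `a(M) = 0`
    (∀ (M : ℤ) (α : SB B), a M = 0 → IsEigenvector a 0 (chiBall α M)) ∧
    -- (b)
    Dense (Submodule.span ℝ (⋃ (M : ℤ) (α : SB B), eVectors M α) : Set (L2 B)) := by
  refine ⟨fun M α hM => ⟨?_, finrank_span_eVectors M α, fun f hf => ?_,
    span_eVectors_eq_kerH_inter ha ha_top α hM⟩, fun M α hM => isEigenvector_chiBall ha ha_top α hM,
    dense_span_eVectors B⟩
  · obtain ⟨f, hf, hne⟩ := exists_ne_zero_mem_eVectors M α
    exact ⟨f, hne, hasH_eVectors ha ha_top M α hf⟩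
  · exact hasH_eVectors ha ha_top M α (mem_span_eVectors_iff.1 hf)
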